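/- Fix a nonzero complex number $t^{1/4}$. Let $A=\{z\in\mathbb{C}: 1\le |z|\le 2\}$, with $m$ marked points $e^{2\pi i(j-1)/m}$ on the inner circle and $n$ marked points $2e^{2\pi i(j-1)/n}$ on the outer circle. An $(m,n)$-tangle diagram is a planar diagram in $A$, with over/under information at its crossings, of arcs ending at the marked points and of closed loops. Let $\mathcal S$ be the skein category of $A$: its objects are the nonnegative integers; $\mathrm{Hom}_{\mathcal S}(m,n)$ is the complex vector space spanned by the classes $[D]$ of $(m,n)$-tangle diagrams up to planar isotopy fixing $\partial A$, modulo the Kauffman skein relation (a crossing equals $t^{1/4}$ times one of its smoothings plus $t^{-1/4}$ times the other; if both strands run from the inside to the outside and the strand turning counterclockwise on its way outwards is on top, then $t^{1/4}$ is the coefficient of the smoothing into two such strands) and modulo the removal of contractible loops, each with the factor $-(t^{1/2}+t^{-1/2})$; in $D'\circ D$ the diagram $D$ is placed inside $D'$. Let $\mathrm{TL}_n=\mathrm{End}_{\mathcal S}(n)$ be the extended affine Temperley--Lieb algebra. Here $\mathrm{TL}_0=\mathbb{C}[X]$, with $X$ the class of a noncontractible loop, and $\mathrm{TL}_1=\mathbb{C}[\rho^{\pm1}]$,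 with $\rho$ the class of an arc winding once counterclockwise from the inner to the outer circle. Let $\mathcal I_n:\mathrm{TL}_n\to \mathrm{TL}_{n+1}$ be the algebra map given by arc insertion: $[D]\mapsto[D^{ins}]$, where $D^{ins}$ is obtained from $D$ by inserting, just before the first marked points in counterclockwise order (so as the last strand, not winding around the annulus), an arc from the inner to the outer circle that passes underneath all the strands it meets. For a left $\mathrm{TL}_{n+1}$-module $N$ let $N^{\mathcal I}$ be its restriction along $\mathcal I_n$. For $u\in\mathbb{C}$ and $v\in\mathbb{C}^\ast$ set $$V_{2k}(u)=\mathrm{Hom}_{\mathcal S}(0,2k)\otimes_{\mathrm{TL}_0}\mathbb{C}_u,\qquad V_{2k+1}(v)=\mathrm{Hom}_{\mathcal S}(1,2k+1)\otimes_{\mathrm{TL}_1}\mathbb{C}_v ,$$ where $X$ acts on $\mathbb{C}_u=\mathbb{C}$ as $u$ and $\rho$ acts on $\mathbb{C}_v=\mathbb{C}$ as $v$; write $Y_u=Y\otimes 1$ and $Z_v=Z\otimes 1$. Let $\emptyset\in\mathrm{End}_{\mathcal S}(0)$ be the class of the empty diagram, $\mathbf 1\in\mathrm{End}_{\mathcal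 S}(1)$ the identity, and $U=t^{1/4}[c_+]+v[c_-]\in\mathrm{Hom}_{\mathcal S}(0,2)$, where $c_+$ and $c_-$ consist of a single arc joining the two outer marked points $2$ and $-2$ through the upper, respectively the lower, half of $A$. Let $u\in\mathbb{C}$ and $v\in\mathbb{C}^\ast$. (i) There is a unique linear map $\phi_0:V_0(u)\to V_1(v)$ with $\phi_0(\emptyset_u)=\mathbf 1_v$; it is nonzero, and $$\mathrm{Hom}_{\mathrm{TL}_0}\bigl(V_0(u),V_1(v)^{\mathcal I}\bigr)=\begin{cases}\mathbb{C}\phi_0 & \text{if } u=t^{1/4}v+t^{-1/4}v^{-1},\\ \{0\} & \text{otherwise.}\end{cases}$$ (ii) If $u=t^{1/4}v+t^{-1/4}v^{-1}$, then there is a unique linear map $\phi_1:V_1(v)\to V_2(u)$ with $\phi_1(\mathbf 1_v)=U_u$, and $\mathrm{Hom}_{\mathrm{TL}_1}\bigl(V_1(v),V_2(u)^{\mathcal I}\bigr)=\mathbb{C}\phi_1$ is one-dimensional. -/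

import Mathlib

open CategoryTheory
open scoped TensorProduct

noncomputable section

namespace AnnularSkein

/-! ## Tangle diagrams in the annulus

The annulus is `1 ≤ |z| ≤ 2`.  The `n` marked points on a boundary circle (or on an intermediate
circle) sit at the angles `2πj/n`, `j = 0, …, n-1`, and are numbered counterclockwise `0, …, n-1`.
The *seam* is a radial segment just before the angle `0`.  A tangle diagram which is generic with
respect to the radius is, read from the inner to the outer boundary, a stack of thin annular
layers, each of which contains exactly one local extremum of the radius (a cup or a cap), or one
crossing, away from the seam, or is a rotation by one position. -/

/-- The local pieces: an arc with both ends on the outer circle (`cup`), an arc with both ends on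
the inner circle (`cap`), and the two crossings of neighbouring strands.  In `pos` the strand that
moves counterclockwise on its way outwards (from position `i` to `i+1`) is on top, in `neg` the
strand that moves clockwise (from position `i+1` to `i`) is on top. -/
inductive Piece
  | cup
  | cap
  | pos
  | neg

/-- Number of inner endpoints of a local piece. -/
def Piece.src : Piece → ℕ
  | .cup => 0
  | .cap => 2
  | .pos => 2
  | .neg => 2

/-- Number of outer endpoints of a local piece. -/
def Piece.tgt : Piece → ℕ
  | .cup => 2
  | .cap => 0
  | .pos => 2
  | .neg => 2

/-- `(m, n)`-tangle diagrams in the annulus (`m` inner and `n` outer endpoints), as stacks of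
layers.
* `idn n`: `n` radial segments;
* `piece e p q`: the layer with `p` strands, then the piece `e`, then `q` strands, counted
  counterclockwise from the seam, no strand meeting the seam;
* `rot n`, `rotInv n`: the layers on `n + 1` strands that rotate every strand by one position
  counterclockwise, respectively clockwise, on its way outwards (so one strand meets the seam);
* `comp D D'`: the diagram `D' ∘ D`, that is, `D` placed inside `D'`. -/
inductive Diagram : ℕ → ℕ → Type
  | idn (n : ℕ) : Diagram n n
  | piece (e : Piece) (p q : ℕ) {m n : ℕ} (hm : m = p + e.src + q) (hn : n = p + e.tgt + q) :
      Diagram m n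
  | rot (n : ℕ) : Diagram (n + 1) (n + 1)
  | rotInv (n : ℕ) : Diagram (n + 1) (n + 1)
  | comp {k m n : ℕ} (D : Diagram k m) (D' : Diagram m n) : Diagram k n

namespace Diagram

/-- The cup layer with `p` strands before and `q` strands after the cup. -/
abbrev cup (p q : ℕ) {m n : ℕ} (hm : m = p + q := by omega) (hn : n = p + 2 + q := by omega) :
    Diagram m n := piece .cup p q hm hn

/-- The cap layer with `p` strands before and `q` strands after the cap. -/
abbrev cap (p q : ℕ) {m n : ℕ} (hm : m = p + 2 + q := by omega) (hn : n = p + q := by omega) :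
    Diagram m n := piece .cap p q hm hn

/-- The layer with the crossing `pos`, with `p` strands before and `q` strands after it. -/
abbrev pos (p q : ℕ) {m n : ℕ} (hm : m = p + 2 + q := by omega)
    (hn : n = p + 2 + q := by omega) : Diagram m n := piece .pos p q hm hn

/-- The layer with the crossing `neg`, with `p` strands before and `q` strands after it. -/
abbrev neg (p q : ℕ) {m n : ℕ} (hm : m = p + 2 + q := by omega)
    (hn : n = p + 2 + q := by omega) : Diagram m n := piece .neg p q hm hn

end Diagram

open Diagram in
/-- Planar isotopy of tangle diagrams in the annulus, fixing the boundary and keeping the crossing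
data: the congruence generated by the elementary isotopies of stacks of layers (the usual
presentation of the category of unoriented tangle diagrams by cups, caps and crossings, together
with the rotations that an annulus requires).  No Reidemeister move is included. -/
inductive PlanarIsotopy : ∀ {m n : ℕ}, Diagram m n → Diagram m n → Prop
  | refl {m n : ℕ} (D : Diagram m n) : PlanarIsotopy D D
  | symm {m n : ℕ} {D D' : Diagram m n} : PlanarIsotopy D D' → PlanarIsotopy D' D
  | trans {m n : ℕ} {D D' D'' : Diagram m n} :
      PlanarIsotopy D D' → PlanarIsotopy D' D'' → PlanarIsotopy D D''
  | congr {k m n : ℕ} {D₁ D₂ : Diagram k m} {E₁ E₂ : Diagram m n} :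
      PlanarIsotopy D₁ D₂ → PlanarIsotopy E₁ E₂ → PlanarIsotopy (comp D₁ E₁) (comp D₂ E₂)
  /- rescaling in the radial direction -/
  | id_comp {m n : ℕ} (D : Diagram m n) : PlanarIsotopy (comp (idn m) D) D
  | comp_id {m n : ℕ} (D : Diagram m n) : PlanarIsotopy (comp D (idn n)) D
  | assoc {j k m n : ℕ} (D : Diagram j k) (E : Diagram k m) (F : Diagram m n) :
      PlanarIsotopy (comp (comp D E) F) (comp D (comp E F))
  /- two pieces in disjoint sectors can be moved past each other radially -/
  | interchange (e e' : Piece) (p q r : ℕ) {m k k' n : ℕ}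
      (hm : m = p + e.src + q + e'.src + r) (hk : k = p + e.tgt + q + e'.src + r)
      (hk' : k' = p + e.src + q + e'.tgt + r) (hn : n = p + e.tgt + q + e'.tgt + r) :
      PlanarIsotopy
        (comp (piece e p (q + e'.src + r) (m := m) (n := k) (by omega) (by omega))
          (piece e' (p + e.tgt + q) r (n := n) (by omega) (by omega)))
        (comp (piece e' (p + e.src + q) r (m := m) (n := k') (by omega) (by omega))
          (piece e p (q + e'.tgt + r) (n := n) (by omega) (by omega)))
  /- straightening a strand -/
  | zigzag (p q : ℕ) : PlanarIsotopy
      (comp (cup p (q + 1) : Diagram (p + q + 1) (p + q + 3)) (cap (p + 1) q)) (idn (p + q + 1))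
  | zagzig (p q : ℕ) : PlanarIsotopy
      (comp (cup (p + 1) q : Diagram (p + q + 1) (p + q + 3)) (cap p (q + 1))) (idn (p + q + 1))
  /- moving a strand that crosses an arc through a local extremum of the radius on that arc -/
  | pos_cap (p q : ℕ) : PlanarIsotopy
      (comp (pos p (q + 1) : Diagram (p + q + 3) (p + q + 3))
        (cap (p + 1) q : Diagram _ (p + q + 1)))
      (comp (neg (p + 1) q : Diagram (p + q + 3) (p + q + 3)) (cap p (q + 1)))
  | neg_cap (p q : ℕ) : PlanarIsotopy
      (comp (neg p (q + 1) : Diagram (p + q + 3) (p + q + 3))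
        (cap (p + 1) q : Diagram _ (p + q + 1)))
      (comp (pos (p + 1) q : Diagram (p + q + 3) (p + q + 3)) (cap p (q + 1)))
  | cup_pos (p q : ℕ) : PlanarIsotopy
      (comp (cup (p + 1) q : Diagram (p + q + 1) (p + q + 3))
        (pos p (q + 1) : Diagram _ (p + q + 3)))
      (comp (cup p (q + 1) : Diagram (p + q + 1) (p + q + 3)) (neg (p + 1) q))
  | cup_neg (p q : ℕ) : PlanarIsotopy
      (comp (cup (p + 1) q : Diagram (p + q + 1) (p + q + 3))
        (neg p (q + 1) : Diagram _ (p + q + 3)))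
      (comp (cup p (q + 1) : Diagram (p + q + 1) (p + q + 3)) (pos (p + 1) q))
  /- rotations in opposite directions cancel -/
  | rot_rotInv (n : ℕ) : PlanarIsotopy (comp (rot n) (rotInv n)) (idn (n + 1))
  | rotInv_rot (n : ℕ) : PlanarIsotopy (comp (rotInv n) (rot n)) (idn (n + 1))
  /- rotating a layer by one position, the piece not passing through the seam -/
  | piece_rot (e : Piece) (p q : ℕ) : PlanarIsotopy
      (comp (piece e p (q + 1) rfl rfl) (rot (p + e.tgt + q)))
      (comp (rot (p + e.src + q)) (piece e (p + 1) q (by omega) (by omega)))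
  /- rotating a layer by two positions, the piece passing through the seam -/
  | cup_rot_rot (p : ℕ) : PlanarIsotopy
      (comp (comp (cup p 0 : Diagram p (p + 2)) (rot (p + 1))) (rot (p + 1))) (cup 0 p)
  | rot_rot_cap (p : ℕ) : PlanarIsotopy
      (comp (comp (rot (p + 1)) (rot (p + 1))) (cap 0 p : Diagram (p + 2) p)) (cap p 0)
  | pos_rot_rot (p : ℕ) : PlanarIsotopy
      (comp (comp (pos p 0 : Diagram (p + 2) (p + 2)) (rot (p + 1))) (rot (p + 1)))
      (comp (comp (rot (p + 1)) (rot (p + 1))) (pos 0 p))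
  | neg_rot_rot (p : ℕ) : PlanarIsotopy
      (comp (comp (neg p 0 : Diagram (p + 2) (p + 2)) (rot (p + 1))) (rot (p + 1)))
      (comp (comp (rot (p + 1)) (rot (p + 1))) (neg 0 p))

/-- Equivalence classes of `(m, n)`-tangle diagrams under planar isotopy: the morphisms of the
category of tangle diagrams in the annulus. -/
def Tangle (m n : ℕ) : Type := Quot (@PlanarIsotopy m n)

/-- The class of a diagram. -/
def Diagram.cls {m n : ℕ} (D : Diagram m n) : Tangle m n := Quot.mk _ D

/-- Composition of tangle diagrams; the first argument is placed inside the second one. -/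
def Tangle.comp {k m n : ℕ} (D : Tangle k m) (D' : Tangle m n) : Tangle k n :=
  Quot.map₂ Diagram.comp (fun _ _ _ h => .congr (.refl _) h) (fun _ _ _ h => .congr h (.refl _))
    D D'

theorem Tangle.assoc {j k m n : ℕ} (D : Tangle j k) (E : Tangle k m) (F : Tangle m n) :
    (D.comp E).comp F = D.comp (E.comp F) := by
  induction D using Quot.ind
  induction E using Quot.ind
  induction F using Quot.ind
  exact Quot.sound (.assoc _ _ _)

theorem Tangle.id_comp {m n : ℕ} (D : Tangle m n) : Tangle.comp (Diagram.idn m).cls D = D := by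
  induction D using Quot.ind
  exact Quot.sound (.id_comp _)

theorem Tangle.comp_id {m n : ℕ} (D : Tangle m n) : Tangle.comp D (Diagram.idn n).cls = D := by
  induction D using Quot.ind
  exact Quot.sound (.comp_id _)

/-! ## The skein category of the annulus

The parameter `t^{1/4}` is the nonzero complex number `s`; thus `t^{1/2} = s²`. -/

variable (s : ℂˣ)

/-- A tangle diagram as a basis vector of the space of formal linear combinations. -/
abbrev basis {m n : ℕ} (D : Tangle m n) : Tangle m n →₀ ℂ := Finsupp.single D 1

open Diagram in
/-- The local relations.  Outside of a small disc the diagrams are given by `F` (inside the layer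
containing the disc), by `G` (outside of it), and by the other strands of that layer.  The two
Kauffman relations are the same local relation, for the two positions of the disc in the layer. -/
inductive SkeinRelator : ∀ {m n : ℕ}, (Tangle m n →₀ ℂ) → Prop
  | kauffman_pos {m n k l : ℕ} (p q : ℕ) (hk : k = p + 2 + q) (hl : l = p + q)
      (F : Tangle m k) (G : Tangle k n) :
      SkeinRelator (basis ((F.comp (pos p q).cls).comp G)
        - ((s : ℂ) • basis (F.comp G)
          + ((s⁻¹ : ℂˣ) : ℂ) •
            basis ((F.comp (comp (cap p q : Diagram k l) (cup p q)).cls).comp G)))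
  | kauffman_neg {m n k l : ℕ} (p q : ℕ) (hk : k = p + 2 + q) (hl : l = p + q)
      (F : Tangle m k) (G : Tangle k n) :
      SkeinRelator (basis ((F.comp (neg p q).cls).comp G)
        - ((s : ℂ) • basis ((F.comp (comp (cap p q : Diagram k l) (cup p q)).cls).comp G)
          + ((s⁻¹ : ℂˣ) : ℂ) • basis (F.comp G)))
  | loop_removal {m n k l : ℕ} (p q : ℕ) (hk : k = p + 2 + q) (hl : l = p + q)
      (F : Tangle m l) (G : Tangle l n) :
      SkeinRelator (basis ((F.comp (comp (cup p q : Diagram l k) (cap p q)).cls).comp G)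
        - (-((s : ℂ) ^ 2 + ((s⁻¹ : ℂˣ) : ℂ) ^ 2)) • basis (F.comp G))

/-- The linear span of the skein relations. -/
def skeinIdeal (m n : ℕ) : Submodule ℂ (Tangle m n →₀ ℂ) :=
  Submodule.span ℂ {x | SkeinRelator s x}

/-- The skein module of `(m, n)`-tangle diagrams in the annulus. -/
abbrev SkeinHom (m n : ℕ) : Type := (Tangle m n →₀ ℂ) ⧸ skeinIdeal s m n

/-- The skein class of a tangle diagram up to planar isotopy. -/
def Tangle.skein {m n : ℕ} (D : Tangle m n) : SkeinHom s m n := (skeinIdeal s m n).mkQ (basis D)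

variable {s} in
theorem SkeinHom.ext {m n : ℕ} {M : Type*} [AddCommGroup M] [Module ℂ M]
    {f g : SkeinHom s m n →ₗ[ℂ] M} (h : ∀ D : Tangle m n, f (D.skein s) = g (D.skein s)) :
    f = g := by
  apply Submodule.linearMap_qext
  ext D
  exact h D

theorem precomp_le {k m n : ℕ} (D : Tangle k m) :
    skeinIdeal s m n ≤ (skeinIdeal s k n).comap (Finsupp.lmapDomain ℂ ℂ D.comp) := by
  refine Submodule.span_le.2 ?_
  intro x (hx : SkeinRelator s x)
  refine Submodule.subset_span ?_
  change SkeinRelator s _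
  cases hx with
  | kauffman_pos p q hk hl F G =>
    simpa only [map_sub, map_add, map_smul, Finsupp.lmapDomain_apply, basis,
      Finsupp.mapDomain_single, Tangle.assoc] using
      SkeinRelator.kauffman_pos (s := s) p q hk hl (D.comp F) G
  | kauffman_neg p q hk hl F G =>
    simpa only [map_sub, map_add, map_smul, Finsupp.lmapDomain_apply, basis,
      Finsupp.mapDomain_single, Tangle.assoc] using
      SkeinRelator.kauffman_neg (s := s) p q hk hl (D.comp F) G
  | loop_removal p q hk hl F G =>
    simpa only [map_sub, map_add, map_smul, Finsupp.lmapDomain_apply, basis,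
      Finsupp.mapDomain_single, Tangle.assoc] using
      SkeinRelator.loop_removal (s := s) p q hk hl (D.comp F) G

theorem postcomp_le {k m n : ℕ} (D : Tangle m n) :
    skeinIdeal s k m ≤ (skeinIdeal s k n).comap
      (Finsupp.lmapDomain ℂ ℂ fun E : Tangle k m => E.comp D) := by
  refine Submodule.span_le.2 ?_
  intro x (hx : SkeinRelator s x)
  refine Submodule.subset_span ?_
  change SkeinRelator s _
  cases hx with
  | kauffman_pos p q hk hl F G =>
    simpa only [map_sub, map_add, map_smul, Finsupp.lmapDomain_apply, basis,
      Finsupp.mapDomain_single, Tangle.assoc] using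
      SkeinRelator.kauffman_pos (s := s) p q hk hl F (G.comp D)
  | kauffman_neg p q hk hl F G =>
    simpa only [map_sub, map_add, map_smul, Finsupp.lmapDomain_apply, basis,
      Finsupp.mapDomain_single, Tangle.assoc] using
      SkeinRelator.kauffman_neg (s := s) p q hk hl F (G.comp D)
  | loop_removal p q hk hl F G =>
    simpa only [map_sub, map_add, map_smul, Finsupp.lmapDomain_apply, basis,
      Finsupp.mapDomain_single, Tangle.assoc] using
      SkeinRelator.loop_removal (s := s) p q hk hl F (G.comp D)

/-- Composition in the skein category before passing to the quotient in the first variable. -/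
def compAux (k m n : ℕ) : (Tangle k m →₀ ℂ) →ₗ[ℂ] SkeinHom s m n →ₗ[ℂ] SkeinHom s k n :=
  Finsupp.linearCombination ℂ fun D =>
    Submodule.mapQ _ _ (Finsupp.lmapDomain ℂ ℂ D.comp) (precomp_le s D)

theorem compAux_apply {k m n : ℕ} (x : Tangle k m →₀ ℂ) (D : Tangle m n) :
    compAux s k m n x (D.skein s) =
      (skeinIdeal s k n).mkQ (Finsupp.lmapDomain ℂ ℂ (fun E : Tangle k m => E.comp D) x) := by
  induction x using Finsupp.induction_linear with
  | zero => simp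
  | add x y hx hy => simp only [map_add, LinearMap.add_apply, hx, hy]
  | single E c =>
    simp only [compAux, Finsupp.linearCombination_single, LinearMap.smul_apply, Tangle.skein,
      basis, Submodule.mkQ_apply, Submodule.mapQ_apply, Finsupp.lmapDomain_apply,
      Finsupp.mapDomain_single]
    rw [← Submodule.Quotient.mk_smul, Finsupp.smul_single, smul_eq_mul, mul_one]

/-- Composition in the skein category: the bilinear extension of the composition of diagrams, with
the first argument placed inside the second one. -/
def SkeinHom.comp (k m n : ℕ) : SkeinHom s k m →ₗ[ℂ] SkeinHom s m n →ₗ[ℂ] SkeinHom s k n :=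
  (skeinIdeal s k m).liftQ (compAux s k m n) <| by
    intro x hx
    rw [LinearMap.mem_ker]
    apply SkeinHom.ext
    intro D
    rw [compAux_apply, LinearMap.zero_apply, Submodule.mkQ_apply, Submodule.Quotient.mk_eq_zero]
    exact postcomp_le s D hx

theorem SkeinHom.comp_skein {k m n : ℕ} (D : Tangle k m) (E : Tangle m n) :
    SkeinHom.comp s k m n (D.skein s) (E.skein s) = (D.comp E).skein s := by
  rw [SkeinHom.comp, Tangle.skein, Submodule.mkQ_apply, Submodule.liftQ_apply, compAux_apply]
  simp [Tangle.skein, Finsupp.mapDomain_single]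

/-- The skein category of the annulus; its objects are the natural numbers. -/
@[ext]
structure SkeinCat (s : ℂˣ) where
  /-- The number of marked points. -/
  pts : ℕ

instance : Category (SkeinCat s) where
  Hom a b := SkeinHom s a.pts b.pts
  id a := (Diagram.idn a.pts).cls.skein s
  comp f g := SkeinHom.comp s _ _ _ f g
  id_comp {a b} f := by
    have h : SkeinHom.comp s _ _ b.pts ((Diagram.idn a.pts).cls.skein s) = LinearMap.id :=
      SkeinHom.ext fun D => by
        rw [SkeinHom.comp_skein, Tangle.id_comp, LinearMap.id_apply]
    exact LinearMap.congr_fun h f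
  comp_id {a b} f := by
    have h : (SkeinHom.comp s a.pts _ _).flip ((Diagram.idn b.pts).cls.skein s) = LinearMap.id :=
      SkeinHom.ext fun D => by
        rw [LinearMap.flip_apply, SkeinHom.comp_skein, Tangle.comp_id, LinearMap.id_apply]
    exact LinearMap.congr_fun h f
  assoc {a b c d} f g h := by
    have H : (LinearMap.llcomp ℂ _ _ _ (SkeinHom.comp s a.pts c.pts d.pts)) ∘ₗ
          SkeinHom.comp s a.pts b.pts c.pts =
        ((LinearMap.llcomp ℂ _ _ _).flip (SkeinHom.comp s b.pts c.pts d.pts)) ∘ₗ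
          (LinearMap.llcomp ℂ (SkeinHom s c.pts d.pts) (SkeinHom s b.pts d.pts)
            (SkeinHom s a.pts d.pts)) ∘ₗ SkeinHom.comp s a.pts b.pts d.pts :=
      SkeinHom.ext fun D => SkeinHom.ext fun E => SkeinHom.ext fun F => by
        simp [SkeinHom.comp_skein, Tangle.assoc]
    exact LinearMap.congr_fun (LinearMap.congr_fun (LinearMap.congr_fun H f) g) h

instance : Preadditive (SkeinCat s) where
  homGroup a b := inferInstanceAs (AddCommGroup (SkeinHom s a.pts b.pts))
  add_comp a b c f f' g := by
    exact LinearMap.map_add₂ (SkeinHom.comp s a.pts b.pts c.pts) f f' g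
  comp_add a b c f g g' := by
    exact LinearMap.map_add (SkeinHom.comp s a.pts b.pts c.pts f) g g'

instance : Linear ℂ (SkeinCat s) where
  homModule a b := inferInstanceAs (Module ℂ (SkeinHom s a.pts b.pts))
  smul_comp a b d c f g := by
    exact LinearMap.map_smul₂ (SkeinHom.comp s a.pts b.pts d.pts) c f g
  comp_smul a b d f c g := by
    exact LinearMap.map_smul (SkeinHom.comp s a.pts b.pts d.pts f) c g

/-- The object `n` of the skein category. -/
abbrev obj (n : ℕ) : SkeinCat s := ⟨n⟩

/-- The skein class `[D]` of a tangle diagram `D`. -/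
def skein {m n : ℕ} (D : Diagram m n) : obj s m ⟶ obj s n := D.cls.skein s

variable {s}

theorem skein_comp {k m n : ℕ} (D : Diagram k m) (E : Diagram m n) :
    skein s (D.comp E) = skein s D ≫ skein s E :=
  (SkeinHom.comp_skein s D.cls E.cls).symm

theorem skein_idn (n : ℕ) : skein s (Diagram.idn n) = 𝟙 (obj s n) := rfl

theorem skein_sound {m n : ℕ} {D E : Diagram m n} (h : PlanarIsotopy D E) :
    skein s D = skein s E :=
  congrArg (Tangle.skein s) (Quot.sound h)

theorem mk_eq_zero_of_relator {m n : ℕ} {x : Tangle m n →₀ ℂ} (h : SkeinRelator s x) :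
    (skeinIdeal s m n).mkQ x = 0 := by
  rw [Submodule.mkQ_apply, Submodule.Quotient.mk_eq_zero]
  exact Submodule.subset_span h

open Diagram

section relations

variable {k l : ℕ} (p q : ℕ) (hk : k = p + 2 + q := by omega) (hl : l = p + q := by omega)

theorem skein_pos : skein s (pos p q hk hk) =
    (s : ℂ) • 𝟙 (obj s k) + ((s⁻¹ : ℂˣ) : ℂ) •
      (skein s (cap p q hk hl) ≫ skein s (cup p q hl hk)) := by
  have h := mk_eq_zero_of_relator
    (SkeinRelator.kauffman_pos (s := s) p q hk hl (idn _).cls (idn _).cls)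
  simp only [Tangle.id_comp, Tangle.comp_id, map_sub, map_add, map_smul] at h
  rw [← skein_comp]
  exact sub_eq_zero.1 h

theorem skein_neg : skein s (neg p q hk hk) =
    (s : ℂ) • (skein s (cap p q hk hl) ≫ skein s (cup p q hl hk)) +
      ((s⁻¹ : ℂˣ) : ℂ) • 𝟙 (obj s k) := by
  have h := mk_eq_zero_of_relator
    (SkeinRelator.kauffman_neg (s := s) p q hk hl (idn _).cls (idn _).cls)
  simp only [Tangle.id_comp, Tangle.comp_id, map_sub, map_add, map_smul] at h
  rw [← skein_comp]
  exact sub_eq_zero.1 h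

theorem skein_loop : skein s (cup p q hl hk) ≫ skein s (cap p q hk hl) =
    (-((s : ℂ) ^ 2 + ((s⁻¹ : ℂˣ) : ℂ) ^ 2)) • 𝟙 (obj s l) := by
  have h := mk_eq_zero_of_relator
    (SkeinRelator.loop_removal (s := s) p q hk hl (idn _).cls (idn _).cls)
  simp only [Tangle.id_comp, Tangle.comp_id, map_sub, map_smul] at h
  rw [← skein_comp]
  exact sub_eq_zero.1 h

/-! ### Reidemeister moves in the skein category -/

theorem skein_neg_pos : skein s (neg p q hk hk) ≫ skein s (pos p q hk hk) = 𝟙 (obj s k) := by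
  have hs : (s : ℂ) ≠ 0 := s.ne_zero
  rw [skein_pos p q hk rfl, skein_neg p q hk rfl]
  set a := skein s (cap p q hk rfl)
  set b := skein s (cup p q rfl hk)
  have hba : b ≫ a = (-((s : ℂ) ^ 2 + ((s⁻¹ : ℂˣ) : ℂ) ^ 2)) • 𝟙 _ := skein_loop p q hk rfl
  have hbab : (a ≫ b) ≫ (a ≫ b) = (-((s : ℂ) ^ 2 + ((s⁻¹ : ℂˣ) : ℂ) ^ 2)) • (a ≫ b) := by
    rw [Category.assoc, ← Category.assoc b a b, hba]
    simp only [Linear.smul_comp, Linear.comp_smul, Category.id_comp]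
  simp only [Preadditive.add_comp, Preadditive.comp_add, Linear.smul_comp, Linear.comp_smul,
    Category.id_comp, Category.comp_id, hbab, smul_smul, smul_add]
  rw [Units.val_inv_eq_inv_val]
  match_scalars <;> field_simp
  ring

theorem skein_pos_neg : skein s (pos p q hk hk) ≫ skein s (neg p q hk hk) = 𝟙 (obj s k) := by
  have hs : (s : ℂ) ≠ 0 := s.ne_zero
  rw [skein_pos p q hk rfl, skein_neg p q hk rfl]
  set a := skein s (cap p q hk rfl)
  set b := skein s (cup p q rfl hk)
  have hba : b ≫ a = (-((s : ℂ) ^ 2 + ((s⁻¹ : ℂˣ) : ℂ) ^ 2)) • 𝟙 _ := skein_loop p q hk rfl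
  have hbab : (a ≫ b) ≫ (a ≫ b) = (-((s : ℂ) ^ 2 + ((s⁻¹ : ℂˣ) : ℂ) ^ 2)) • (a ≫ b) := by
    rw [Category.assoc, ← Category.assoc b a b, hba]
    simp only [Linear.smul_comp, Linear.comp_smul, Category.id_comp]
  simp only [Preadditive.add_comp, Preadditive.comp_add, Linear.smul_comp, Linear.comp_smul,
    Category.id_comp, Category.comp_id, hbab, smul_smul, smul_add]
  rw [Units.val_inv_eq_inv_val]
  match_scalars <;> field_simp
  ring

end relations

section slides

variable (p q : ℕ)

/-- A strand slides below a cup. -/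
theorem skein_cup_slide :
    skein s (cup p (q + 1) : Diagram (p + q + 1) (p + q + 3)) ≫
      skein s (pos (p + 1) q : Diagram (p + q + 3) (p + q + 3)) ≫
      skein s (pos p (q + 1) : Diagram (p + q + 3) (p + q + 3)) =
    skein s (cup (p + 1) q) := by
  have h := skein_sound (s := s) (PlanarIsotopy.cup_neg p q)
  rw [skein_comp, skein_comp] at h
  rw [← Category.assoc, ← h, Category.assoc, skein_neg_pos p (q + 1), Category.comp_id]

/-- A strand slides below a cap. -/
theorem skein_cap_slide :
    skein s (pos (p + 1) q : Diagram (p + q + 3) (p + q + 3)) ≫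
      skein s (pos p (q + 1) : Diagram (p + q + 3) (p + q + 3)) ≫
      skein s (cap (p + 1) q : Diagram (p + q + 3) (p + q + 1)) =
    skein s (cap p (q + 1)) := by
  have h := skein_sound (s := s) (PlanarIsotopy.pos_cap p q)
  rw [skein_comp, skein_comp] at h
  rw [h, ← Category.assoc, skein_pos_neg (p + 1) q, Category.id_comp]

theorem skein_cap_cup_slide :
    (skein s (cap p (q + 1) : Diagram (p + q + 3) (p + q + 1)) ≫
      skein s (cup p (q + 1) : Diagram (p + q + 1) (p + q + 3))) ≫
      skein s (pos (p + 1) q : Diagram (p + q + 3) (p + q + 3)) ≫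
      skein s (pos p (q + 1) : Diagram (p + q + 3) (p + q + 3)) =
    skein s (pos (p + 1) q : Diagram (p + q + 3) (p + q + 3)) ≫
      skein s (pos p (q + 1) : Diagram (p + q + 3) (p + q + 3)) ≫
      (skein s (cap (p + 1) q : Diagram (p + q + 3) (p + q + 1)) ≫
        skein s (cup (p + 1) q : Diagram (p + q + 1) (p + q + 3))) := by
  rw [Category.assoc, skein_cup_slide, ← skein_cap_slide p q]
  simp only [Category.assoc]

theorem skein_pos_slide :
    skein s (pos p (q + 1) : Diagram (p + q + 3) (p + q + 3)) ≫
      skein s (pos (p + 1) q : Diagram (p + q + 3) (p + q + 3)) ≫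
      skein s (pos p (q + 1) : Diagram (p + q + 3) (p + q + 3)) =
    skein s (pos (p + 1) q : Diagram (p + q + 3) (p + q + 3)) ≫
      skein s (pos p (q + 1) : Diagram (p + q + 3) (p + q + 3)) ≫
      skein s (pos (p + 1) q : Diagram (p + q + 3) (p + q + 3)) := by
  have h := skein_cap_cup_slide (s := s) p q
  generalize hA : skein s (pos (p + 1) q : Diagram (p + q + 3) (p + q + 3)) ≫
    skein s (pos p (q + 1) : Diagram (p + q + 3) (p + q + 3)) = A at h ⊢
  rw [← Category.assoc _ (skein s (pos p (q + 1))) (skein s (pos (p + 1) q)), hA]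
  rw [← Category.assoc _ (skein s (pos p (q + 1))) (_ ≫ _), hA] at h
  rw [skein_pos p (q + 1) (by omega) (l := p + q + 1) (by omega),
    skein_pos (p + 1) q (by omega) (l := p + q + 1) (by omega)]
  simp only [Preadditive.add_comp, Preadditive.comp_add, Linear.smul_comp, Linear.comp_smul,
    Category.id_comp, Category.comp_id, h]

theorem skein_neg_slide :
    skein s (neg p (q + 1) : Diagram (p + q + 3) (p + q + 3)) ≫
      skein s (pos (p + 1) q : Diagram (p + q + 3) (p + q + 3)) ≫
      skein s (pos p (q + 1) : Diagram (p + q + 3) (p + q + 3)) =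
    skein s (pos (p + 1) q : Diagram (p + q + 3) (p + q + 3)) ≫
      skein s (pos p (q + 1) : Diagram (p + q + 3) (p + q + 3)) ≫
      skein s (neg (p + 1) q : Diagram (p + q + 3) (p + q + 3)) := by
  have h := skein_cap_cup_slide (s := s) p q
  generalize hA : skein s (pos (p + 1) q : Diagram (p + q + 3) (p + q + 3)) ≫
    skein s (pos p (q + 1) : Diagram (p + q + 3) (p + q + 3)) = A at h ⊢
  rw [← Category.assoc _ (skein s (pos p (q + 1))) (skein s (neg (p + 1) q)), hA]
  rw [← Category.assoc _ (skein s (pos p (q + 1))) (_ ≫ _), hA] at h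
  rw [skein_neg p (q + 1) (by omega) (l := p + q + 1) (by omega),
    skein_neg (p + 1) q (by omega) (l := p + q + 1) (by omega)]
  simp only [Preadditive.add_comp, Preadditive.comp_add, Linear.smul_comp, Linear.comp_smul,
    Category.id_comp, Category.comp_id, h]

/-- Two rotations, each preceded by a crossing with the last strand. -/
theorem skein_rot_rot_ins (p : ℕ) :
    skein s (comp (comp (pos (p + 1) 0) (rot (p + 2))) (comp (pos (p + 1) 0) (rot (p + 2)))) =
      skein s (pos (p + 1) 0 : Diagram (p + 3) (p + 3)) ≫
        skein s (pos p 1 : Diagram (p + 3) (p + 3)) ≫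
        skein s (comp (rot (p + 2)) (rot (p + 2))) := by
  have h : skein s (comp (pos p 1 : Diagram (p + 3) (p + 3)) (rot (p + 2))) =
      skein s (comp (rot (p + 2)) (pos (p + 1) 0)) :=
    skein_sound (PlanarIsotopy.piece_rot .pos p 0)
  rw [skein_comp, skein_comp] at h
  simp only [skein_comp, Category.assoc]
  rw [← Category.assoc (skein s (pos p 1)), h, Category.assoc]

end slides

/-! ## Arc insertion -/

/-- Arc insertion on diagrams: insert an arc from the inner to the outer boundary just before the
seam (as the last strand), going underneath all strands it meets.  The strands it meets are those
that meet the seam: in a rotation layer, the one strand that passes through the seam crosses over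
the inserted arc. -/
def Diagram.ins : ∀ {m n : ℕ}, Diagram m n → Diagram (m + 1) (n + 1)
  | _, _, .idn n => .idn (n + 1)
  | _, _, .piece e p q hm hn => .piece e p (q + 1) (by omega) (by omega)
  | _, _, .rot n => .comp (.pos n 0) (.rot (n + 1))
  | _, _, .rotInv n => .comp (.rotInv (n + 1)) (.neg n 0)
  | _, _, .comp D D' => .comp D.ins D'.ins

theorem skein_ins_sound {m n : ℕ} {D E : Diagram m n} (h : PlanarIsotopy D E) :
    skein s D.ins = skein s E.ins := by
  induction h with
  | refl D => rfl
  | symm _ ih => exact ih.symm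
  | trans _ _ ih₁ ih₂ => exact ih₁.trans ih₂
  | congr _ _ ih₁ ih₂ => simp only [Diagram.ins, skein_comp, ih₁, ih₂]
  | id_comp D => exact skein_sound (.id_comp _)
  | comp_id D => exact skein_sound (.comp_id _)
  | assoc D E F => exact skein_sound (.assoc _ _ _)
  | interchange e e' p q r hm hk hk' hn =>
    exact skein_sound (.interchange e e' p q (r + 1) (by omega) (by omega) (by omega) (by omega))
  | zigzag p q => exact skein_sound (.zigzag p (q + 1))
  | zagzig p q => exact skein_sound (.zagzig p (q + 1))
  | pos_cap p q => exact skein_sound (.pos_cap p (q + 1))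
  | neg_cap p q => exact skein_sound (.neg_cap p (q + 1))
  | cup_pos p q => exact skein_sound (.cup_pos p (q + 1))
  | cup_neg p q => exact skein_sound (.cup_neg p (q + 1))
  | rot_rotInv n =>
    have h := skein_sound (s := s) (PlanarIsotopy.rot_rotInv (n + 1))
    rw [skein_comp, skein_idn] at h
    simp only [Diagram.ins, skein_comp, Category.assoc]
    rw [← Category.assoc (skein s (rot (n + 1))), h, Category.id_comp]
    exact skein_pos_neg n 0 (by omega)
  | rotInv_rot n =>
    have h := skein_sound (s := s) (PlanarIsotopy.rotInv_rot (n + 1))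
    rw [skein_comp, skein_idn] at h
    simp only [Diagram.ins, skein_comp, Category.assoc]
    rw [← Category.assoc (skein s (neg n 0)), skein_neg_pos n 0 (by omega), Category.id_comp]
    exact h
  | piece_rot e p q =>
    have h₁ := skein_sound (s := s) (PlanarIsotopy.piece_rot e p (q + 1))
    have h₂ := skein_sound (s := s) (PlanarIsotopy.interchange e .pos p q 0
      (m := p + e.src + q + 2) (k := p + e.tgt + q + 2) (k' := p + e.src + q + 2)
      (n := p + e.tgt + q + 2) rfl rfl rfl rfl)
    rw [skein_comp, skein_comp] at h₁ h₂
    simp only [Diagram.ins, skein_comp]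
    rw [← Category.assoc]
    erw [h₂]
    rw [Category.assoc, Category.assoc]
    erw [h₁]
    rfl
  | cup_rot_rot p =>
    have h := skein_sound (s := s) (PlanarIsotopy.cup_rot_rot (p + 1))
    rw [skein_sound (.assoc _ _ _), skein_comp] at h
    have h' := skein_sound (s := s)
      (PlanarIsotopy.assoc (cup p 0 : Diagram p (p + 2)).ins (rot (p + 1)).ins (rot (p + 1)).ins)
    refine h'.trans ?_
    rw [skein_comp]
    erw [skein_rot_rot_ins p]
    rw [← Category.assoc, ← Category.assoc, Category.assoc _ _ (skein s (pos p 1))]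
    erw [skein_cup_slide p 0]
    exact h
  | rot_rot_cap p =>
    have h := skein_sound (s := s) (PlanarIsotopy.rot_rot_cap (p + 1))
    rw [skein_comp] at h
    change skein s (comp (comp (comp (pos (p + 1) 0) (rot (p + 2)))
      (comp (pos (p + 1) 0) (rot (p + 2)))) (cap 0 (p + 1))) = _
    rw [skein_comp, skein_rot_rot_ins p, Category.assoc, Category.assoc]
    erw [h]
    exact skein_cap_slide p 0
  | pos_rot_rot p =>
    have h := skein_sound (s := s) (PlanarIsotopy.pos_rot_rot (p + 1))
    rw [skein_sound (.assoc _ _ _), skein_comp, skein_comp _ (pos 0 (p + 1))] at h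
    have h' := skein_sound (s := s)
      (PlanarIsotopy.assoc (pos p 0 : Diagram (p + 2) (p + 2)).ins (rot (p + 1)).ins
        (rot (p + 1)).ins)
    refine h'.trans ?_
    change _ = skein s (comp (comp (comp (pos (p + 1) 0) (rot (p + 2)))
      (comp (pos (p + 1) 0) (rot (p + 2)))) (pos 0 (p + 1)))
    rw [skein_comp, skein_comp _ (pos 0 (p + 1)), skein_rot_rot_ins p, Category.assoc,
      Category.assoc]
    erw [← h]
    erw [skein_rot_rot_ins p]
    have h₃ := skein_pos_slide (s := s) p 0
    rw [← Category.assoc, ← Category.assoc, Category.assoc _ _ (skein s (pos p 1))]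
    erw [h₃]
    simp only [Category.assoc]
  | neg_rot_rot p =>
    have h := skein_sound (s := s) (PlanarIsotopy.neg_rot_rot (p + 1))
    rw [skein_sound (.assoc _ _ _), skein_comp, skein_comp _ (neg 0 (p + 1))] at h
    have h' := skein_sound (s := s)
      (PlanarIsotopy.assoc (neg p 0 : Diagram (p + 2) (p + 2)).ins (rot (p + 1)).ins
        (rot (p + 1)).ins)
    refine h'.trans ?_
    change _ = skein s (comp (comp (comp (pos (p + 1) 0) (rot (p + 2)))
      (comp (pos (p + 1) 0) (rot (p + 2)))) (neg 0 (p + 1)))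
    rw [skein_comp, skein_comp _ (neg 0 (p + 1)), skein_rot_rot_ins p, Category.assoc,
      Category.assoc]
    erw [← h]
    erw [skein_rot_rot_ins p]
    have h₃ := skein_neg_slide (s := s) p 0
    rw [← Category.assoc, ← Category.assoc, Category.assoc _ _ (skein s (pos p 1))]
    erw [h₃]
    simp only [Category.assoc]

/-- The skein class `[D^ins]`, for a tangle diagram `D` up to planar isotopy. -/
def Tangle.ins (s : ℂˣ) {m n : ℕ} (D : Tangle m n) : SkeinHom s (m + 1) (n + 1) :=
  Quot.lift (fun E : Diagram m n => E.ins.cls.skein s)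
    (fun E E' h => show E.ins.cls.skein s = E'.ins.cls.skein s from skein_ins_sound h) D

theorem skeinIdeal_le_ker_ins (m n : ℕ) : skeinIdeal s m n ≤
    LinearMap.ker (Finsupp.linearCombination ℂ fun D : Tangle m n => D.ins s) := by
  refine Submodule.span_le.2 ?_
  intro x (hx : SkeinRelator s x)
  rw [SetLike.mem_coe, LinearMap.mem_ker]
  cases hx with
  | @kauffman_pos k l p q hk hl F G =>
    induction F using Quot.ind with | _ F
    induction G using Quot.ind with | _ G
    simp only [map_sub, map_add, map_smul, basis, Finsupp.linearCombination_single, one_smul]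
    refine sub_eq_zero.2 ?_
    change skein s (Diagram.comp (Diagram.comp F.ins (pos p (q + 1))) G.ins) =
      (s : ℂ) • skein s (Diagram.comp F.ins G.ins) + ((s⁻¹ : ℂˣ) : ℂ) •
        skein s (Diagram.comp (Diagram.comp F.ins (Diagram.comp (cap p (q + 1) : Diagram (k + 1) (l + 1))
          (cup p (q + 1)))) G.ins)
    simp only [skein_comp]
    rw [skein_pos p (q + 1) (by omega) (l := l + 1) (by omega)]
    simp only [Preadditive.add_comp, Preadditive.comp_add, Linear.smul_comp, Linear.comp_smul,
      Category.comp_id]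
  | @kauffman_neg k l p q hk hl F G =>
    induction F using Quot.ind with | _ F
    induction G using Quot.ind with | _ G
    simp only [map_sub, map_add, map_smul, basis, Finsupp.linearCombination_single, one_smul]
    refine sub_eq_zero.2 ?_
    change skein s (Diagram.comp (Diagram.comp F.ins (neg p (q + 1))) G.ins) =
      (s : ℂ) • skein s (Diagram.comp (Diagram.comp F.ins (Diagram.comp (cap p (q + 1) : Diagram (k + 1) (l + 1))
          (cup p (q + 1)))) G.ins) + ((s⁻¹ : ℂˣ) : ℂ) • skein s (Diagram.comp F.ins G.ins)
    simp only [skein_comp]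
    rw [skein_neg p (q + 1) (by omega) (l := l + 1) (by omega)]
    simp only [Preadditive.add_comp, Preadditive.comp_add, Linear.smul_comp, Linear.comp_smul,
      Category.comp_id]
  | @loop_removal k l p q hk hl F G =>
    induction F using Quot.ind with | _ F
    induction G using Quot.ind with | _ G
    simp only [map_sub, map_smul, basis, Finsupp.linearCombination_single, one_smul]
    refine sub_eq_zero.2 ?_
    change skein s (Diagram.comp (Diagram.comp F.ins (Diagram.comp (cup p (q + 1) : Diagram (l + 1) (k + 1))
          (cap p (q + 1)))) G.ins) =
      (-((s : ℂ) ^ 2 + ((s⁻¹ : ℂˣ) : ℂ) ^ 2)) • skein s (Diagram.comp F.ins G.ins)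
    simp only [skein_comp]
    rw [skein_loop p (q + 1) (by omega) (by omega)]
    simp only [Linear.smul_comp, Linear.comp_smul, Category.comp_id]

variable (s) in
/-- Arc insertion `[D] ↦ [D^ins]` on skein modules. -/
def SkeinHom.ins (m n : ℕ) : SkeinHom s m n →ₗ[ℂ] SkeinHom s (m + 1) (n + 1) :=
  (skeinIdeal s m n).liftQ (Finsupp.linearCombination ℂ fun D : Tangle m n => D.ins s)
    (skeinIdeal_le_ker_ins m n)

theorem SkeinHom.ins_skein {m n : ℕ} (D : Diagram m n) :
    SkeinHom.ins s m n (D.cls.skein s) = D.ins.cls.skein s := by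
  rw [SkeinHom.ins, Tangle.skein, Submodule.mkQ_apply, Submodule.liftQ_apply,
    Finsupp.linearCombination_single, one_smul]
  rfl

variable (s) in
/-- The arc insertion functor. -/
def arcInsertion : SkeinCat s ⥤ SkeinCat s where
  obj a := ⟨a.pts + 1⟩
  map {a b} f := SkeinHom.ins s a.pts b.pts f
  map_id a := SkeinHom.ins_skein (idn a.pts)
  map_comp {a b c} f g := by
    have H : (SkeinHom.comp s a.pts b.pts c.pts).compr₂ (SkeinHom.ins s _ _) =
        (SkeinHom.comp s _ _ _).compl₁₂ (SkeinHom.ins s a.pts b.pts)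
          (SkeinHom.ins s b.pts c.pts) :=
      SkeinHom.ext fun D => SkeinHom.ext fun E => by
        induction D using Quot.ind with | _ D
        induction E using Quot.ind with | _ E
        change SkeinHom.ins s _ _ (SkeinHom.comp s _ _ _ (D.cls.skein s) (E.cls.skein s)) =
          SkeinHom.comp s _ _ _ (SkeinHom.ins s _ _ (D.cls.skein s))
            (SkeinHom.ins s _ _ (E.cls.skein s))
        rw [SkeinHom.ins_skein, SkeinHom.ins_skein, SkeinHom.comp_skein, SkeinHom.comp_skein]
        exact SkeinHom.ins_skein (Diagram.comp D E)
    exact LinearMap.congr_fun (LinearMap.congr_fun H f) g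

/-! ## The extended affine Temperley-Lieb algebras and their modules -/

variable (s)

/-- The `n`-th extended affine Temperley-Lieb algebra in its skein theoretic realization, the
endomorphism algebra of `n` in the skein category.  Multiplication is composition:
`a * b = a ∘ b` has `b` placed inside `a`. -/
abbrev TL (n : ℕ) : Type := End (obj s n)

/-- The algebra map `TL_n → TL_{n+1}` given by arc insertion. -/
def insertionHom (n : ℕ) : TL s n →ₐ[ℂ] TL s (n + 1) where
  toFun f := (arcInsertion s).map f
  map_one' := (arcInsertion s).map_id _
  map_mul' f g := (arcInsertion s).map_comp g f
  map_zero' := map_zero (SkeinHom.ins s n n)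
  map_add' f g := map_add (SkeinHom.ins s n n) f g
  commutes' c := by
    have h : (arcInsertion s).map (c • 𝟙 (obj s n)) = c • 𝟙 (obj s (n + 1)) :=
      (map_smul (SkeinHom.ins s n n) c _).trans
        (congrArg (c • ·) ((arcInsertion s).map_id (obj s n)))
    simp only [Algebra.algebraMap_eq_smul_one]
    exact h

/-- The generator `X` of `TL_0`: the skein class of a noncontractible loop. -/
def ncLoop : TL s 0 := skein s (comp (comp (cup 0 0) (rot 1)) (cap 0 0))

/-- The generator `ρ` of `TL_1`: an arc winding once counterclockwise on its way outwards. -/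
def rho : (TL s 1)ˣ where
  val := skein s (rot 0)
  inv := skein s (rotInv 0)
  val_inv := (skein_comp _ _).symm.trans (skein_sound (.rotInv_rot 0))
  inv_val := (skein_comp _ _).symm.trans (skein_sound (.rot_rotInv 0))

/-- `Hom(0, n)` as a right module over `TL_0 = ℂ[X]`, via `X ↦ ncLoop`. -/
instance instModulePoly (n : ℕ) : Module (Polynomial ℂ) (obj s 0 ⟶ obj s n) :=
  Module.compHom _
    (Polynomial.aeval (MulOpposite.op (ncLoop s)) : Polynomial ℂ →ₐ[ℂ] (TL s 0)ᵐᵒᵖ).toRingHom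

/-- `Hom(1, n)` as a right module over `TL_1 = ℂ[ρ, ρ⁻¹]`, via `ρ ↦ rho`. -/
instance instModuleLaurent (n : ℕ) : Module (LaurentPolynomial ℂ) (obj s 1 ⟶ obj s n) :=
  Module.compHom _
    (AddMonoidAlgebra.lift ℂ (TL s 1)ᵐᵒᵖ ℤ ((Units.coeHom (TL s 1)ᵐᵒᵖ).comp
      (zpowersHom (TL s 1)ᵐᵒᵖˣ (Units.opEquiv.symm (MulOpposite.op (rho s)))))).toRingHom

theorem poly_smul_def {n : ℕ} (p : Polynomial ℂ) (f : obj s 0 ⟶ obj s n) :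
    p • f = (Polynomial.aeval (MulOpposite.op (ncLoop s)) p : (TL s 0)ᵐᵒᵖ).unop ≫ f := rfl

instance (n : ℕ) : SMulCommClass (Polynomial ℂ) (TL s n) (obj s 0 ⟶ obj s n) where
  smul_comm _ a f := (Category.assoc _ f a).symm

instance (n : ℕ) : SMulCommClass (Polynomial ℂ) ℂ (obj s 0 ⟶ obj s n) where
  smul_comm _ c f := Linear.comp_smul _ _ _ _ c f

instance (n : ℕ) : SMulCommClass (LaurentPolynomial ℂ) (TL s n) (obj s 1 ⟶ obj s n) where
  smul_comm _ a f := (Category.assoc _ f a).symm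

instance (n : ℕ) : SMulCommClass (LaurentPolynomial ℂ) ℂ (obj s 1 ⟶ obj s n) where
  smul_comm _ c f := Linear.comp_smul _ _ _ _ c f

instance (m n : ℕ) : SMulCommClass (TL s n) ℂ (obj s m ⟶ obj s n) where
  smul_comm a c f := Linear.smul_comp _ _ _ c f a

/-- The one-dimensional module over `TL_0 = ℂ[X]` on which `X` acts as `u`. -/
def C₀ (_ : ℂ) : Type := ℂ

instance (u : ℂ) : AddCommGroup (C₀ u) := inferInstanceAs (AddCommGroup ℂ)

instance (u : ℂ) : Module (Polynomial ℂ) (C₀ u) :=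
  Module.compHom ℂ (Polynomial.evalRingHom u)

/-- The one-dimensional module over `TL_1 = ℂ[ρ, ρ⁻¹]` on which `ρ` acts as `v`. -/
def C₁ (_ : ℂˣ) : Type := ℂ

instance (v : ℂˣ) : AddCommGroup (C₁ v) := inferInstanceAs (AddCommGroup ℂ)

instance (v : ℂˣ) : Module (LaurentPolynomial ℂ) (C₁ v) :=
  Module.compHom ℂ (LaurentPolynomial.eval₂ (RingHom.id ℂ) v)

/-- `Hom(0, n) ⊗_{TL_0} ℂ_u`, a left module over `TL s n` by composition in the first factor; this
is `V_n(u)` for even `n`. -/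
abbrev VEven (n : ℕ) (u : ℂ) : Type := (obj s 0 ⟶ obj s n) ⊗[Polynomial ℂ] C₀ u

/-- `Hom(1, n) ⊗_{TL_1} ℂ_v`, a left module over `TL s n` by composition in the first factor; this
is `V_n(v)` for odd `n`. -/
abbrev VOdd (n : ℕ) (v : ℂˣ) : Type := (obj s 1 ⟶ obj s n) ⊗[LaurentPolynomial ℂ] C₁ v

/-- The element `Y_u = Y ⊗ 1` for `Y ∈ Hom(0, n)`. -/
def VEven.mk {n : ℕ} (u : ℂ) (Y : obj s 0 ⟶ obj s n) : VEven s n u :=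
  Y ⊗ₜ[Polynomial ℂ] (show C₀ u from (1 : ℂ))

/-- The element `Z_v = Z ⊗ 1` for `Z ∈ Hom(1, n)`. -/
def VOdd.mk {n : ℕ} (v : ℂˣ) (Z : obj s 1 ⟶ obj s n) : VOdd s n v :=
  Z ⊗ₜ[LaurentPolynomial ℂ] (show C₁ v from (1 : ℂ))

/-- For an algebra map `η : A → B`, the space `Hom_A(M, Res^η N)` of intertwiners from the left
`A`-module `M` to the restriction along `η` of the left `B`-module `N`. -/
def intertwiners {A B : Type} [Ring A] [Algebra ℂ A] [Ring B] [Algebra ℂ B] (η : A →ₐ[ℂ] B)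
    (M N : Type) [AddCommGroup M] [Module ℂ M] [Module A M]
    [AddCommGroup N] [Module ℂ N] [Module B N] [SMulCommClass B ℂ N] :
    Submodule ℂ (M →ₗ[ℂ] N) where
  carrier := {f | ∀ (a : A) (x : M), f (a • x) = η a • f x}
  zero_mem' a x := by simp
  add_mem' {f g} hf hg a x := by
    rw [LinearMap.add_apply, LinearMap.add_apply, hf a x, hg a x, smul_add]
  smul_mem' c f hf a x := by
    rw [LinearMap.smul_apply, LinearMap.smul_apply, hf a x]
    exact (smul_comm (η a) c (f x)).symm

/-- The skein class of the `(0, 2)`-diagram whose arc runs counterclockwise from the first to the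
second marked point (through the upper half of the annulus). -/
def cPlus : obj s 0 ⟶ obj s 2 := skein s (cup 0 0)

/-- The skein class of the `(0, 2)`-diagram whose arc runs counterclockwise from the second to the
first marked point (through the lower half of the annulus). -/
def cMinus : obj s 0 ⟶ obj s 2 := skein s (comp (cup 0 0) (rot 1))

/-- The element `U = t^{1/4} [c_+] + v [c_-]` of `Hom(0, 2)`. -/
def bigU (v : ℂˣ) : obj s 0 ⟶ obj s 2 := (s : ℂ) • cPlus s + (v : ℂ) • cMinus s

end AnnularSkein

end

open CategoryTheory
open scoped TensorProduct

noncomputable section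

namespace AnnularSkein

open Diagram

variable {s : ℂˣ}

/-! ## Spanning sets -/

/-! Write `s` for `t^{1/4}`. Both source modules are lines, `V_0(u)` spanned by the class of the
empty diagram and `V_1(v)` by the class of the identity, and `TL_0`, `TL_1` are generated by the
loop `X` and by `ρ^{±1}`. An intertwiner is therefore the choice of one vector `w` in the target,
subject to one eigenvector equation: `I_0(X) w = u w` in `V_1(v)`, respectively `I_1(ρ) w = v w` in
`V_2(u)`.

The inserted generators are computed by resolving their single crossing. For `I_0(X)` the two
smoothings are the two windings of an arc, so `I_0(X) = s ρ + s⁻¹ ρ⁻¹` (`insertionHom_ncLoop`),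
which acts on the line `V_1(v)` as `s v + s⁻¹ v⁻¹`. This gives (i). On `V_2(u)`, with basis `c₊`,
`c₋`, the operator `I_1(ρ)` sends `c₊` to `-s⁻³ c₋` and `c₋` to `s c₊ + s⁻¹ u c₋`. The
`c₊`-coordinate of the eigenvector equation for `a c₊ + b c₋` reads `s b = v a`, so every solution
is a multiple of `U`; the `c₋`-coordinate for `U` is exactly `u = s v + s⁻¹ v⁻¹`. This gives (ii).

The real work is the structure of these small modules. Upper bounds: words in cups and rotations
span the Hom spaces, because their span is stable under every layer (`comp_skein_mem`,
`cupSpan_eq_top`). Lower bounds: a twisted spin chain, with two states per strand and a factor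
`z^{±1}` for passing the seam, is a representation of the skein category (`act_eq_of_isotopy`,
`skeinIdeal_le_ker_spin`) in which `X` acts by `z + z⁻¹`. Its matrix entries show that the two lines
are nonzero. For generic `z` they separate `c₊` from `c₋`; by polynomiality `Hom(0,2)` is then free
over `ℂ[X]` on `c₊`, `c₋` (`poly_eq_zero_of_smul_cPlus_add`), and this freeness specializes to every
`u`. -/

/-- Rotation by one position on any number of strands. -/
def turn (s : ℂˣ) : ∀ n : ℕ, End (obj s n)
  | 0 => 𝟙 _
  | n + 1 => skein s (rot n)

/-- The inverse rotation by one position on any number of strands. -/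
def turnInv (s : ℂˣ) : ∀ n : ℕ, End (obj s n)
  | 0 => 𝟙 _
  | n + 1 => skein s (rotInv n)

theorem turn_turnInv (n : ℕ) : turn s n ≫ turnInv s n = 𝟙 (obj s n) := by
  cases n with
  | zero => exact Category.id_comp _
  | succ n => exact (skein_comp _ _).symm.trans (skein_sound (.rot_rotInv n))

theorem turnInv_turn (n : ℕ) : turnInv s n ≫ turn s n = 𝟙 (obj s n) := by
  cases n with
  | zero => exact Category.id_comp _
  | succ n => exact (skein_comp _ _).symm.trans (skein_sound (.rotInv_rot n))

theorem turn_pow_succ (n a : ℕ) : (turn s n ^ (a + 1)) = (turn s n ^ a) ≫ turn s n :=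
  pow_succ' _ _

theorem turn_pow_succ' (n a : ℕ) : (turn s n ^ (a + 1)) = turn s n ≫ (turn s n ^ a) :=
  pow_succ _ _

theorem turn_pow_add (n a b : ℕ) : (turn s n ^ (a + b)) = (turn s n ^ a) ≫ (turn s n ^ b) := by
  rw [add_comm]; exact pow_add _ _ _

theorem turnInv_pow_turn_pow (n a : ℕ) : (turnInv s n ^ a) ≫ (turn s n ^ a) = 𝟙 (obj s n) := by
  induction a with
  | zero => exact Category.id_comp _
  | succ a ih =>
    rw [turn_pow_succ', show (turnInv s n ^ (a + 1)) = (turnInv s n ^ a) ≫ turnInv s n from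
      pow_succ' _ _, Category.assoc, ← Category.assoc (turnInv s n), turnInv_turn,
      Category.id_comp, ih]

theorem piece_turn (e : Piece) (p q : ℕ) {m n : ℕ} (hm : m = p + e.src + (q + 1))
    (hn : n = p + e.tgt + (q + 1)) (hm' : m = p + 1 + e.src + q) (hn' : n = p + 1 + e.tgt + q) :
    skein s (piece e p (q + 1) hm hn) ≫ turn s n =
      turn s m ≫ skein s (piece e (p + 1) q hm' hn') := by
  subst hm hn
  have h := skein_sound (s := s) (PlanarIsotopy.piece_rot e p q)
  rw [skein_comp, skein_comp] at h
  exact h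

theorem piece_turn_pow (e : Piece) (a b : ℕ) {m n c : ℕ} (hc : c = a + b)
    (hm : m = 0 + e.src + c) (hn : n = 0 + e.tgt + c) (hm' : m = a + e.src + b)
    (hn' : n = a + e.tgt + b) :
    skein s (piece e 0 c hm hn) ≫ (turn s n ^ a) =
      (turn s m ^ a) ≫ skein s (piece e a b hm' hn') := by
  induction a generalizing b with
  | zero =>
    obtain rfl : c = b := by omega
    exact (Category.comp_id _).trans (Category.id_comp _).symm
  | succ a ih =>
    rw [turn_pow_succ, turn_pow_succ, ← Category.assoc,
      ih (b + 1) (by omega) (by omega) (by omega), Category.assoc, Category.assoc,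
      piece_turn e a b (by omega) (by omega) hm' hn']

/-- A full turn on the outside can be carried out on the inside: `n` of the `n + 2` steps carry the
cup up to the seam, and the last two carry it through the seam back to its starting place. The `n`
inner rotations are the full turn on the remaining strands. -/
theorem cup_turn_pow (n : ℕ) :
    skein s (cup 0 n : Diagram n (n + 2)) ≫ (turn s (n + 2) ^ (n + 2)) =
      (turn s n ^ n) ≫ skein s (cup 0 n : Diagram n (n + 2)) := by
  have h := skein_sound (s := s) (PlanarIsotopy.cup_rot_rot n)
  rw [skein_comp, skein_comp] at h
  rw [turn_pow_succ, turn_pow_succ, ← Category.assoc, ← Category.assoc,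
    piece_turn_pow .cup n 0 (m := n) (n := n + 2) (by omega) (by simp [Piece.src])
      (by simp [Piece.tgt]; omega) (by simp [Piece.src]) (by simp [Piece.tgt]),
    Category.assoc, Category.assoc]
  congr 1
  rw [← Category.assoc]
  exact h

/-- Reduces closure under cups and caps in arbitrary position to pieces in position `0` and
rotations. -/
theorem piece_eq_conj (e : Piece) (a b : ℕ) {m n c : ℕ} (hc : c = a + b)
    (hm : m = 0 + e.src + c) (hn : n = 0 + e.tgt + c) (hm' : m = a + e.src + b)
    (hn' : n = a + e.tgt + b) :
    skein s (piece e a b hm' hn') =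
      (turnInv s m ^ a) ≫ skein s (piece e 0 c hm hn) ≫ (turn s n ^ a) := by
  rw [piece_turn_pow e a b hc hm hn hm' hn', ← Category.assoc, turnInv_pow_turn_pow,
    Category.id_comp]

theorem skein_interchange (e e' : Piece) (p q r : ℕ) {a a' b b' m k k' n : ℕ}
    (ha : a = q + e'.src + r) (ha' : a' = q + e'.tgt + r) (hb : b = p + e.tgt + q)
    (hb' : b' = p + e.src + q) (h₁ : m = p + e.src + a) (h₂ : k = p + e.tgt + a)
    (h₃ : k = b + e'.src + r) (h₄ : n = b + e'.tgt + r) (h₅ : m = b' + e'.src + r)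
    (h₆ : k' = b' + e'.tgt + r) (h₇ : k' = p + e.src + a') (h₈ : n = p + e.tgt + a') :
    skein s (piece e p a h₁ h₂) ≫ skein s (piece e' b r h₃ h₄) =
      skein s (piece e' b' r h₅ h₆) ≫ skein s (piece e p a' h₇ h₈) := by
  subst ha ha' hb hb'
  have h := skein_sound (s := s) (PlanarIsotopy.interchange e e' p q r h₅ h₃ h₆ h₄)
  rw [skein_comp, skein_comp] at h
  exact h

theorem skein_zigzag (p q : ℕ) {m n : ℕ} (hm : m = p + (q + 1)) (hn : n = p + 2 + (q + 1))
    (hn' : n = p + 1 + 2 + q) (hm' : m = p + 1 + q) :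
    skein s (cup p (q + 1) hm hn) ≫ skein s (cap (p + 1) q hn' hm') = 𝟙 (obj s m) := by
  obtain rfl : m = p + q + 1 := by omega
  obtain rfl : n = p + q + 3 := by omega
  have h := skein_sound (s := s) (PlanarIsotopy.zigzag p q)
  rw [skein_comp, skein_idn] at h
  exact h

theorem skein_zagzig (p q : ℕ) {m n : ℕ} (hm : m = p + 1 + q) (hn : n = p + 1 + 2 + q)
    (hn' : n = p + 2 + (q + 1)) (hm' : m = p + (q + 1)) :
    skein s (cup (p + 1) q hm hn) ≫ skein s (cap p (q + 1) hn' hm') = 𝟙 (obj s m) := by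
  obtain rfl : m = p + q + 1 := by omega
  obtain rfl : n = p + q + 3 := by omega
  have h := skein_sound (s := s) (PlanarIsotopy.zagzig p q)
  rw [skein_comp, skein_idn] at h
  exact h

/-- Words of cups and rotations, applied to given spaces of diagrams with at most one outer
endpoint. -/
def cupSpan {m : ℕ} (W₀ : Submodule ℂ (obj s m ⟶ obj s 0)) (W₁ : Submodule ℂ (obj s m ⟶ obj s 1)) :
    ∀ n : ℕ, Submodule ℂ (obj s m ⟶ obj s n)
  | 0 => W₀
  | 1 => W₁
  | n + 2 => ⨆ a : ℕ, (cupSpan W₀ W₁ n).map (Linear.rightComp ℂ (obj s m)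
      (skein s (cup 0 n : Diagram n (n + 2)) ≫ (turn s (n + 2) ^ a)))

/-! ### Stability of the span of cup words under all layers -/

section closure

variable {m : ℕ} {W₀ : Submodule ℂ (obj s m ⟶ obj s 0)} {W₁ : Submodule ℂ (obj s m ⟶ obj s 1)}

theorem mem_cupSpan {n : ℕ} {f : obj s m ⟶ obj s n} (hf : f ∈ cupSpan W₀ W₁ n) (a : ℕ) :
    f ≫ skein s (cup 0 n : Diagram n (n + 2)) ≫ (turn s (n + 2) ^ a) ∈ cupSpan W₀ W₁ (n + 2) :=
  Submodule.mem_iSup_of_mem a (Submodule.mem_map_of_mem (f := Linear.rightComp ℂ _ _) hf)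

theorem cupSpan_induction {n k : ℕ} {g : obj s (n + 2) ⟶ obj s k}
    {N : Submodule ℂ (obj s m ⟶ obj s k)}
    (h : ∀ f ∈ cupSpan W₀ W₁ n, ∀ a : ℕ,
      f ≫ skein s (cup 0 n : Diagram n (n + 2)) ≫ (turn s (n + 2) ^ a) ≫ g ∈ N)
    {f : obj s m ⟶ obj s (n + 2)} (hf : f ∈ cupSpan W₀ W₁ (n + 2)) : f ≫ g ∈ N := by
  have H : cupSpan W₀ W₁ (n + 2) ≤ N.comap (Linear.rightComp ℂ (obj s m) g) := by
    refine iSup_le fun a => Submodule.map_le_iff_le_comap.2 fun f hf => ?_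
    have := h f hf a
    simpa only [Submodule.mem_comap, Linear.rightComp_apply, Category.assoc] using this
  exact H hf

variable (h₁ : ∀ f ∈ W₁, f ≫ skein s (rot 0) ∈ W₁)
  (h₁' : ∀ f ∈ W₁, f ≫ skein s (rotInv 0) ∈ W₁)

include h₁ in
theorem comp_turn_mem {n : ℕ} {f : obj s m ⟶ obj s n} (hf : f ∈ cupSpan W₀ W₁ n) :
    f ≫ turn s n ∈ cupSpan W₀ W₁ n := by
  match n with
  | 0 => exact (Category.comp_id f).symm ▸ hf
  | 1 => exact h₁ f hf
  | n + 2 =>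
    refine cupSpan_induction (fun f hf a => ?_) hf
    rw [← turn_pow_succ]
    exact mem_cupSpan hf _

include h₁ in
theorem comp_turn_pow_mem {n : ℕ} (a : ℕ) {f : obj s m ⟶ obj s n} (hf : f ∈ cupSpan W₀ W₁ n) :
    f ≫ (turn s n ^ a) ∈ cupSpan W₀ W₁ n := by
  induction a with
  | zero => exact (Category.comp_id f).symm ▸ hf
  | succ a ih =>
    rw [turn_pow_succ, ← Category.assoc]
    exact comp_turn_mem h₁ ih

-- Only nonnegative powers of the rotation occur in `cupSpan`. Since a full turn on `n + 2` strands
-- passes through the cup as a full turn on `n` strands, an inverse step outside is `n + 1` forward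
-- steps outside together with a full inverse turn inside, which the two-step induction controls.
include h₁' in
theorem comp_turnInv_mem {n : ℕ} {f : obj s m ⟶ obj s n} (hf : f ∈ cupSpan W₀ W₁ n) :
    f ≫ turnInv s n ∈ cupSpan W₀ W₁ n := by
  induction n using Nat.twoStepInduction with
  | zero => exact (Category.comp_id f).symm ▸ hf
  | one => exact h₁' f hf
  | more n ih _ =>
    have hpow (k : ℕ) {f : obj s m ⟶ obj s n} (hf : f ∈ cupSpan W₀ W₁ n) :
        f ≫ (turnInv s n ^ k) ∈ cupSpan W₀ W₁ n := by
      induction k with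
      | zero => exact (Category.comp_id f).symm ▸ hf
      | succ k ihk =>
        rw [show (turnInv s n ^ (k + 1)) = (turnInv s n ^ k) ≫ turnInv s n from pow_succ' _ _,
          ← Category.assoc]
        exact ih ihk
    refine cupSpan_induction (fun f hf a => ?_) hf
    -- `a - 1 = (n + 1 + a) - (n + 2)`, and the full turn by `n + 2` is traded for the inner turn by
    -- `n`; this avoids subtracting when `a = 0`.
    have key : f ≫ skein s (cup 0 n : Diagram n (n + 2)) ≫ (turn s (n + 2) ^ a) ≫ turnInv s (n + 2) =
        (f ≫ (turnInv s n ^ n)) ≫ skein s (cup 0 n : Diagram n (n + 2)) ≫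
          (turn s (n + 2) ^ (n + 1 + a)) := by
      have e₁ : (turn s (n + 2) ^ (n + 1 + a)) =
          (turn s (n + 2) ^ (n + 2)) ≫ (turn s (n + 2) ^ a) ≫ turnInv s (n + 2) := by
        rw [← Category.assoc, ← turn_pow_add, show n + 2 + a = n + 1 + a + 1 by omega,
          turn_pow_succ _ (n + 1 + a), Category.assoc, turn_turnInv, Category.comp_id]
      rw [e₁, ← Category.assoc (skein s _) ((turn s (n + 2) ^ (n + 2))), cup_turn_pow,
        Category.assoc, Category.assoc, ← Category.assoc ((turnInv s n ^ n)),
        turnInv_pow_turn_pow, Category.id_comp]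
    rw [key]
    exact mem_cupSpan (hpow n hf) _

include h₁' in
theorem comp_turnInv_pow_mem {n : ℕ} (a : ℕ) {f : obj s m ⟶ obj s n}
    (hf : f ∈ cupSpan W₀ W₁ n) : f ≫ (turnInv s n ^ a) ∈ cupSpan W₀ W₁ n := by
  induction a with
  | zero => exact (Category.comp_id f).symm ▸ hf
  | succ a ih =>
    rw [show (turnInv s n ^ (a + 1)) = (turnInv s n ^ a) ≫ turnInv s n from pow_succ' _ _,
      ← Category.assoc]
    exact comp_turnInv_mem h₁' ih

include h₁' in
theorem comp_cup_mem {k n : ℕ} (p q : ℕ) (hk : k = p + q) (hn : n = p + 2 + q)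
    {f : obj s m ⟶ obj s k} (hf : f ∈ cupSpan W₀ W₁ k) :
    f ≫ skein s (cup p q hk hn) ∈ cupSpan W₀ W₁ n := by
  obtain rfl : n = k + 2 := by omega
  rw [show skein s (cup p q hk hn) = _ from piece_eq_conj .cup p q (c := k) hk
    (by simp [Piece.src]) (by simp [Piece.tgt]; omega) hk hn, ← Category.assoc]
  exact mem_cupSpan (comp_turnInv_pow_mem h₁' p hf) p

variable (h₀ : ∀ f ∈ W₀, f ≫ ncLoop s ∈ W₀)

-- Modulo full turns, a cup followed by `a` rotations and a cap has `0 ≤ a ≤ n + 1`. The two arcs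
-- share both ends (a loop, contractible for `a = 0`, noncontractible for `n = 0`, `a = 1`), share
-- one end (`a = 1` or `a = n + 1` with `n > 0`, a strand to be straightened), or are disjoint (`2 ≤
-- a ≤ n`). In the disjoint case the cap moves inside the cup and is absorbed by the hypothesis `ih`
-- on fewer strands.
include h₀ h₁ h₁' in
theorem comp_cup_turn_cap_mem (n : ℕ)
    (ih : ∀ k (_ : n = k + 2), ∀ f ∈ cupSpan W₀ W₁ n,
      f ≫ skein s (cap 0 k : Diagram n k) ∈ cupSpan W₀ W₁ k)
    (a : ℕ) {f : obj s m ⟶ obj s n} (hf : f ∈ cupSpan W₀ W₁ n) :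
    f ≫ skein s (cup 0 n : Diagram n (n + 2)) ≫ (turn s (n + 2) ^ a) ≫
      skein s (cap 0 n : Diagram (n + 2) n) ∈ cupSpan W₀ W₁ n := by
  induction a using Nat.strong_induction_on generalizing f with
  | _ a iha =>
  rcases Nat.lt_or_ge a (n + 2) with ha | ha
  · rcases Nat.eq_zero_or_pos a with rfl | ha0
    · have h : skein s (cup 0 n : Diagram n (n + 2)) ≫ (turn s (n + 2) ^ 0) ≫
          skein s (cap 0 n : Diagram (n + 2) n) = _ :=
        (congrArg _ (Category.id_comp _)).trans (skein_loop (s := s) 0 n (by omega) (by omega))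
      rw [h, Linear.comp_smul, Category.comp_id]
      exact Submodule.smul_mem _ _ hf
    rcases Nat.eq_zero_or_pos n with rfl | hn
    · obtain rfl : a = 1 := by omega
      have h : skein s (cup 0 0 : Diagram 0 2) ≫ (turn s 2 ^ 1) ≫ skein s (cap 0 0 : Diagram 2 0) =
          ncLoop s := by
        rw [pow_one, ncLoop, skein_comp, skein_comp, Category.assoc]; rfl
      rw [h]
      exact h₀ f hf
    rcases Nat.lt_or_ge n a with han | han
    · obtain rfl : a = n + 1 := by omega
      obtain ⟨k, rfl⟩ : ∃ k, n = k + 1 := ⟨n - 1, by omega⟩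
      -- Here the cup and the cap meet across the seam. Writing the rotation as a full turn minus
      -- one step brings them next to each other on one side of it, where `skein_zigzag` applies;
      -- what remains is a full turn minus one step on the `k + 1` strands.
      have h1 : (turn s (k + 1 + 2) ^ (k + 1 + 1)) =
          (turn s (k + 1 + 2) ^ (k + 1 + 2)) ≫ turnInv s (k + 1 + 2) := by
        rw [turn_pow_succ _ (k + 1 + 1), Category.assoc, turn_turnInv, Category.comp_id]
      have h2 := piece_turn (s := s) .cap 0 k (m := k + 1 + 2) (n := k + 1)
        (by simp [Piece.src]; omega) (by simp [Piece.tgt]) (by simp [Piece.src]; omega)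
        (by simp [Piece.tgt]; omega)
      have h3 : turnInv s (k + 1 + 2) ≫ skein s (cap 0 (k + 1) : Diagram (k + 1 + 2) (k + 1)) =
          skein s (cap 1 k : Diagram (k + 1 + 2) (k + 1)) ≫ turnInv s (k + 1) := by
        rw [← Category.comp_id (skein s (cap 0 (k + 1))), ← turn_turnInv,
          ← Category.assoc (skein s _)]
        erw [h2]
        rw [Category.assoc, ← Category.assoc, turnInv_turn, Category.id_comp]
      have h5 : skein s (cup 0 (k + 1) : Diagram (k + 1) (k + 1 + 2)) ≫
          skein s (cap 1 k : Diagram (k + 1 + 2) (k + 1)) = 𝟙 _ :=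
        skein_zigzag 0 k _ _ _ _
      rw [h1, Category.assoc, h3, ← Category.assoc (skein s (cup 0 (k + 1))), cup_turn_pow,
        Category.assoc, ← Category.assoc (skein s (cup 0 (k + 1))), h5, Category.id_comp,
        ← Category.assoc]
      exact comp_turnInv_mem h₁' (comp_turn_pow_mem h₁ _ hf)
    · obtain ⟨r, rfl⟩ : ∃ r, n = a + r := ⟨n - a, by omega⟩
      rw [← Category.assoc (skein s (cup 0 (a + r))),
        piece_turn_pow .cup a r (m := a + r) (n := a + r + 2) rfl (by simp [Piece.src])
          (by simp [Piece.tgt]; omega) (by simp [Piece.src]) (by simp [Piece.tgt]; omega),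
        Category.assoc, ← Category.assoc]
      have hf' := comp_turn_pow_mem h₁ a hf
      rcases Nat.lt_or_ge 1 a with ha1 | ha1
      · obtain ⟨q, rfl⟩ : ∃ q, a = q + 2 := ⟨a - 2, by omega⟩
        -- The cup now sits after at least two strands and the cap acts on the first two, so they
        -- occupy disjoint sectors and can be interchanged.
        obtain ⟨k, hk⟩ : ∃ k, k = q + r := ⟨_, rfl⟩
        have h' : skein s (cup (q + 2) r : Diagram (q + 2 + r) (q + 2 + r + 2)) ≫
            skein s (cap 0 (q + 2 + r) : Diagram (q + 2 + r + 2) (q + 2 + r)) =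
            skein s (cap 0 k : Diagram (q + 2 + r) k) ≫
              skein s (cup q r : Diagram k (q + 2 + r)) :=
          (skein_interchange .cap .cup 0 q r hk rfl (Nat.zero_add q).symm
            (by simp [Piece.src]; omega) _ _ _ _ _ _ _ _).symm
        have hcap : (f ≫ (turn s (q + 2 + r) ^ (q + 2))) ≫
            skein s (cap 0 k : Diagram (q + 2 + r) k) ∈ cupSpan W₀ W₁ k :=
          ih k (by omega) _ hf'
        have := comp_cup_mem h₁' q r hk (n := q + 2 + r) (by omega) hcap
        rw [Category.assoc, ← h'] at this
        exact this
      · obtain rfl : a = 1 := by omega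
        have h' : skein s (cup 1 r : Diagram (1 + r) (1 + r + 2)) ≫
            skein s (cap 0 (1 + r) : Diagram (1 + r + 2) (1 + r)) = 𝟙 _ := by
          have H : ∀ c (hc : c = r + 1) (h₁ : 1 + r + 2 = 0 + 2 + c) (h₂ : 1 + r = 0 + c),
            skein s (cup 1 r : Diagram (1 + r) (1 + r + 2)) ≫ skein s (cap 0 c h₁ h₂) = 𝟙 _ := by
            rintro c rfl h₁ h₂
            exact skein_zagzig 0 r _ _ _ _
          exact H _ (by omega) _ _
        erw [h']
        rw [Category.comp_id]
        exact hf'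
  · obtain ⟨b, rfl⟩ : ∃ b, a = n + 2 + b := ⟨a - (n + 2), by omega⟩
    rw [turn_pow_add, Category.assoc, ← Category.assoc (skein s (cup 0 n)), cup_turn_pow,
      Category.assoc, ← Category.assoc]
    exact iha b (by omega) (comp_turn_pow_mem h₁ n hf)

include h₀ h₁ h₁' in
theorem comp_cap_zero_mem (n : ℕ) : ∀ f ∈ cupSpan W₀ W₁ (n + 2),
    f ≫ skein s (cap 0 n : Diagram (n + 2) n) ∈ cupSpan W₀ W₁ n := by
  induction n using Nat.strong_induction_on with
  | _ n ih =>
  intro f hf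
  refine cupSpan_induction (fun f hf a => ?_) hf
  exact comp_cup_turn_cap_mem h₁ h₁' h₀ n (fun k hk => by subst hk; exact ih k (by omega)) a hf

include h₀ h₁ h₁' in
theorem comp_cap_mem {k n : ℕ} (p q : ℕ) (hk : k = p + 2 + q) (hn : n = p + q)
    {f : obj s m ⟶ obj s k} (hf : f ∈ cupSpan W₀ W₁ k) :
    f ≫ skein s (cap p q hk hn) ∈ cupSpan W₀ W₁ n := by
  obtain rfl : k = n + 2 := by omega
  rw [show skein s (cap p q hk hn) = _ from piece_eq_conj .cap p q (c := n) hn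
    (by simp [Piece.src]; omega) (by simp [Piece.tgt]) hk hn, ← Category.assoc, ← Category.assoc]
  exact comp_turn_pow_mem h₁ _ (comp_cap_zero_mem h₁ h₁' h₀ n _ (comp_turnInv_pow_mem h₁' p hf))

-- Crossings need no separate argument: the Kauffman relation turns each into a combination of the
-- identity and a cap followed by a cup.
include h₀ h₁ h₁' in
theorem comp_skein_mem {k n : ℕ} (D : Diagram k n) {f : obj s m ⟶ obj s k}
    (hf : f ∈ cupSpan W₀ W₁ k) : f ≫ skein s D ∈ cupSpan W₀ W₁ n := by
  induction D with
  | idn n => exact (Category.comp_id f).symm ▸ hf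
  | rot n => exact comp_turn_mem (n := n + 1) h₁ hf
  | rotInv n => exact comp_turnInv_mem (n := n + 1) h₁' hf
  | comp D E ihD ihE =>
    rw [skein_comp, ← Category.assoc]
    exact ihE (ihD hf)
  | @piece e p q k n hm hn =>
    cases e with
    | cup => exact comp_cup_mem h₁' p q hm hn hf
    | cap => exact comp_cap_mem h₁ h₁' h₀ p q hm hn hf
    | pos =>
      obtain rfl : k = n := hm.trans hn.symm
      have := skein_pos (s := s) p q hm rfl
      erw [this]
      rw [Preadditive.comp_add, Linear.comp_smul, Linear.comp_smul, Category.comp_id,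
        ← Category.assoc]
      exact Submodule.add_mem _ (Submodule.smul_mem _ _ hf) (Submodule.smul_mem _ _
        (comp_cup_mem h₁' p q _ _ (comp_cap_mem h₁ h₁' h₀ p q _ _ hf)))
    | neg =>
      obtain rfl : k = n := hm.trans hn.symm
      have := skein_neg (s := s) p q hm rfl
      erw [this]
      rw [Preadditive.comp_add, Linear.comp_smul, Linear.comp_smul, Category.comp_id,
        ← Category.assoc]
      exact Submodule.add_mem _ (Submodule.smul_mem _ _
        (comp_cup_mem h₁' p q _ _ (comp_cap_mem h₁ h₁' h₀ p q _ _ hf)))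
        (Submodule.smul_mem _ _ hf)

-- The span contains the identity and is stable under composition with every diagram, hence contains
-- every diagram.
include h₀ h₁ h₁' in
theorem cupSpan_eq_top (hid : 𝟙 (obj s m) ∈ cupSpan W₀ W₁ m) (n : ℕ) :
    cupSpan W₀ W₁ n = ⊤ := by
  refine eq_top_iff.2 fun f _ => ?_
  obtain ⟨x, rfl⟩ := Submodule.mkQ_surjective (skeinIdeal s m n) f
  induction x using Finsupp.induction_linear with
  | zero => rw [map_zero]; exact Submodule.zero_mem _
  | add x y hx hy => rw [map_add]; exact Submodule.add_mem _ (hx trivial) (hy trivial)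
  | single D c =>
    induction D using Quot.ind with | _ D
    have h := comp_skein_mem h₁ h₁' h₀ D hid
    rw [Category.id_comp] at h
    have h' := Submodule.smul_mem _ c h
    convert h' using 1
    change _ = c • (skeinIdeal s m n).mkQ (Finsupp.single D.cls 1)
    rw [← map_smul, Finsupp.smul_single, smul_eq_mul, mul_one]
    rfl

end closure

/-! ### Generators of Hom(0,0), Hom(1,1) and Hom(0,2) -/

/-- `TL_0` is spanned by the powers of the noncontractible loop. -/
theorem span_ncLoop_pow : Submodule.span ℂ (Set.range fun k : ℕ => ncLoop s ^ k) = ⊤ := by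
  -- Strands end in pairs, so from `0` points only even levels matter, and `⊥` is a stable choice at
  -- the odd level.
  refine cupSpan_eq_top (m := 0) (W₀ := Submodule.span ℂ (Set.range fun k : ℕ => (ncLoop s ^ k : TL s 0)))
    (W₁ := ⊥) ?_ ?_ ?_ ?_ 0
  · rintro f hf; rw [(Submodule.mem_bot ℂ).1 hf, Limits.zero_comp]; exact Submodule.zero_mem _
  · rintro f hf; rw [(Submodule.mem_bot ℂ).1 hf, Limits.zero_comp]; exact Submodule.zero_mem _
  · intro f hf
    induction hf using Submodule.span_induction with
    | mem x h =>
      obtain ⟨k, rfl⟩ := h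
      exact Submodule.subset_span ⟨k + 1, pow_succ' (ncLoop s) k⟩
    | zero => rw [Limits.zero_comp]; exact Submodule.zero_mem _
    | add x y _ _ hx hy => rw [Preadditive.add_comp]; exact Submodule.add_mem _ hx hy
    | smul c x _ hx => rw [Linear.smul_comp]; exact Submodule.smul_mem _ _ hx
  · exact Submodule.subset_span ⟨0, pow_zero (ncLoop s)⟩

/-- `TL_1` is spanned by the powers of `ρ`. -/
theorem span_rho_zpow :
    Submodule.span ℂ (Set.range fun k : ℤ => ((rho s ^ k : (TL s 1)ˣ) : TL s 1)) = ⊤ := by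
  refine cupSpan_eq_top (m := 1) (W₀ := ⊥)
    (W₁ := Submodule.span ℂ (Set.range fun k : ℤ => ((rho s ^ k : (TL s 1)ˣ) : TL s 1)))
    ?_ ?_ ?_ ?_ 1
  · intro f hf
    induction hf using Submodule.span_induction with
    | mem x h =>
      obtain ⟨k, rfl⟩ := h
      refine Submodule.subset_span ⟨1 + k, ?_⟩
      change ((rho s ^ (1 + k) : (TL s 1)ˣ) : TL s 1) = (rho s : TL s 1) * _
      rw [zpow_add, zpow_one, Units.val_mul]
    | zero => rw [Limits.zero_comp]; exact Submodule.zero_mem _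
    | add x y _ _ hx hy => rw [Preadditive.add_comp]; exact Submodule.add_mem _ hx hy
    | smul c x _ hx => rw [Linear.smul_comp]; exact Submodule.smul_mem _ _ hx
  · intro f hf
    induction hf using Submodule.span_induction with
    | mem x h =>
      obtain ⟨k, rfl⟩ := h
      refine Submodule.subset_span ⟨-1 + k, ?_⟩
      change ((rho s ^ (-1 + k) : (TL s 1)ˣ) : TL s 1) = (((rho s)⁻¹ : (TL s 1)ˣ) : TL s 1) * _
      rw [zpow_add, zpow_neg_one, Units.val_mul]
    | zero => rw [Limits.zero_comp]; exact Submodule.zero_mem _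
    | add x y _ _ hx hy => rw [Preadditive.add_comp]; exact Submodule.add_mem _ hx hy
    | smul c x _ hx => rw [Linear.smul_comp]; exact Submodule.smul_mem _ _ hx
  · intro f hf; rw [(Submodule.mem_bot ℂ).1 hf, Limits.zero_comp]; exact Submodule.zero_mem _
  · exact Submodule.subset_span ⟨0, by simp⟩

theorem cPlus_comp_rot : cPlus s ≫ skein s (rot 1) = cMinus s := (skein_comp _ _).symm

theorem cMinus_comp_rot : cMinus s ≫ skein s (rot 1) = cPlus s := by
  have h := skein_sound (s := s) (PlanarIsotopy.cup_rot_rot 0)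
  rw [skein_comp] at h
  exact h

/-- `Hom(0, 2)` is generated by `c₊` and `c₋` under precomposition with `TL_0`. -/
theorem exists_eq_comp_cPlus_add_comp_cMinus (f : obj s 0 ⟶ obj s 2) :
    ∃ x y : obj s 0 ⟶ obj s 0, f = x ≫ cPlus s + y ≫ cMinus s := by
  let N : Submodule ℂ (obj s 0 ⟶ obj s 2) :=
    LinearMap.range (Linear.rightComp ℂ (obj s 0) (cPlus s)) ⊔
      LinearMap.range (Linear.rightComp ℂ (obj s 0) (cMinus s))
  -- On two outer points the rotation swaps the two arcs, so the infinitely many generators at level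
  -- `2` collapse to two.
  have key : ∀ (a : ℕ), cPlus s ≫ (turn s 2 ^ a) = cPlus s ∨ cPlus s ≫ (turn s 2 ^ a) = cMinus s := by
    intro a
    induction a with
    | zero => exact .inl (Category.comp_id _)
    | succ a ih =>
      rw [turn_pow_succ, ← Category.assoc]
      rcases ih with h | h <;> rw [h]
      · exact .inr cPlus_comp_rot
      · exact .inl cMinus_comp_rot
  have hf : f ∈ cupSpan (⊤ : Submodule ℂ (obj s 0 ⟶ obj s 0)) ⊥ 2 := by
    rw [cupSpan_eq_top]
    · trivial
    · rintro f hf; rw [(Submodule.mem_bot ℂ).1 hf, Limits.zero_comp]; exact Submodule.zero_mem _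
    · rintro f hf; rw [(Submodule.mem_bot ℂ).1 hf, Limits.zero_comp]; exact Submodule.zero_mem _
    · intros; trivial
    · trivial
  have hN : f ≫ 𝟙 _ ∈ N := by
    refine cupSpan_induction (fun g _ a => ?_) hf
    rw [Category.comp_id]
    rcases key a with h | h
    · exact Submodule.mem_sup_left ⟨g, congrArg (g ≫ ·) h.symm⟩
    · exact Submodule.mem_sup_right ⟨g, congrArg (g ≫ ·) h.symm⟩
  rw [Category.comp_id] at hN
  obtain ⟨_, ⟨x, rfl⟩, _, ⟨y, rfl⟩, h⟩ := Submodule.mem_sup.1 hN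
  exact ⟨x, y, h.symm⟩

/-! ## The twisted spin chain representation -/

section spin

variable (s z : ℂˣ)

/-- Values of the cup on spins. -/
def cupWeight : Bool → Bool → ℂ
  | true, false => s
  | false, true => -(s : ℂ)⁻¹
  | _, _ => 0

/-- Values of the cap on spins. -/
def capWeight : Bool → Bool → ℂ
  | true, false => -s
  | false, true => (s : ℂ)⁻¹
  | _, _ => 0

/-- Matrix coefficients of the local pieces. -/
def Piece.weight : Piece → List Bool → List Bool → ℂ
  | .cup, [], [x, y] => cupWeight s x y
  | .cap, [x, y], [] => capWeight s x y
  | .pos, [x, y], [x', y'] =>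
    (if x = x' ∧ y = y' then (s : ℂ) else 0) + (s : ℂ)⁻¹ * (capWeight s x y * cupWeight s x' y')
  | .neg, [x, y], [x', y'] =>
    (if x = x' ∧ y = y' then (s : ℂ)⁻¹ else 0) + s * (capWeight s x y * cupWeight s x' y')
  | _, _, _ => 0

/-- The possible spins at the inner endpoints of a local piece. -/
def Piece.inputs : Piece → Finset (List Bool)
  | .cup => {[]}
  | _ => {[true, true], [true, false], [false, true], [false, false]}

theorem Piece.length_of_mem_inputs {e : Piece} {i : List Bool} (h : i ∈ e.inputs) :
    i.length = e.src := by
  cases e <;> simp only [Piece.inputs, Finset.mem_insert, Finset.mem_singleton] at h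
  · subst h; rfl
  all_goals rcases h with rfl | rfl | rfl | rfl <;> rfl

/-- The weight picked up by a strand passing through the seam. -/
def twist : Bool → ℂ
  | true => z
  | false => (z : ℂ)⁻¹

theorem twist_ne_zero (x : Bool) : twist z x ≠ 0 := by
  cases x <;> simp [twist]

/-- The action of a local piece, placed after `p` strands. -/
def pieceAct (e : Piece) (p : ℕ) : (List Bool → ℂ) →ₗ[ℂ] (List Bool → ℂ) where
  toFun ψ w := ∑ i ∈ e.inputs, e.weight s i ((w.drop p).take e.tgt) *
    ψ (w.take p ++ (i ++ w.drop (p + e.tgt)))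
  map_add' ψ φ := by ext w; simp [mul_add, Finset.sum_add_distrib]
  map_smul' c ψ := by
    ext w
    simp only [Pi.smul_apply, smul_eq_mul, RingHom.id_apply, Finset.mul_sum]
    exact Finset.sum_congr rfl fun i _ => by ring

theorem pieceAct_append (e : Piece) {p : ℕ} {a o : List Bool} (b : List Bool) (ψ : List Bool → ℂ)
    (ha : a.length = p) (ho : o.length = e.tgt) :
    pieceAct s e p ψ (a ++ (o ++ b)) = ∑ i ∈ e.inputs, e.weight s i o * ψ (a ++ (i ++ b)) := by
  subst ha
  simp only [pieceAct, LinearMap.coe_mk, AddHom.coe_mk, List.drop_left, List.take_left, ← ho,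
    ← List.drop_drop]

/-- The action of the rotation. -/
def rotAct : (List Bool → ℂ) →ₗ[ℂ] (List Bool → ℂ) where
  toFun ψ w := twist z (w.headD true) * ψ (w.tail ++ [w.headD true])
  map_add' ψ φ := by ext w; simp [mul_add]
  map_smul' c ψ := by ext w; simp; ring

/-- The action of the inverse rotation. -/
def rotInvAct : (List Bool → ℂ) →ₗ[ℂ] (List Bool → ℂ) where
  toFun ψ w := (twist z (w.getLastD true))⁻¹ * ψ (w.getLastD true :: w.dropLast)
  map_add' ψ φ := by ext w; simp [mul_add]
  map_smul' c ψ := by ext w; simp; ring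

theorem rotAct_cons (x : Bool) (w : List Bool) (ψ : List Bool → ℂ) :
    rotAct z ψ (x :: w) = twist z x * ψ (w ++ [x]) := rfl

theorem rotInvAct_append (x : Bool) (w : List Bool) (ψ : List Bool → ℂ) :
    rotInvAct z ψ (w ++ [x]) = (twist z x)⁻¹ * ψ (x :: w) := by
  simp [rotInvAct]

/-- The action of a diagram on functions of spin configurations. -/
def Diagram.act : ∀ {m n : ℕ}, Diagram m n → (List Bool → ℂ) →ₗ[ℂ] (List Bool → ℂ)
  | _, _, .idn _ => LinearMap.id
  | _, _, .piece e p _ _ _ => pieceAct s e p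
  | _, _, .rot _ => rotAct z
  | _, _, .rotInv _ => rotInvAct z
  | _, _, .comp D E => E.act ∘ₗ D.act

variable {s z}

/-! ### Locality and isotopy invariance of the spin action -/

theorem exists_append_of_length {w : List Bool} {p t q : ℕ} (hw : w.length = p + t + q) :
    ∃ a o b : List Bool, w = a ++ (o ++ b) ∧ a.length = p ∧ o.length = t ∧ b.length = q :=
  ⟨w.take p, (w.drop p).take t, (w.drop p).drop t, by simp, by simp; omega, by simp; omega,
    by simp; omega⟩

/-- Operators act on functions of words of all lengths, whereas isotopy invariance holds only on
words of the correct length. This locality makes the restricted equalities compatible with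
composition. -/
theorem Diagram.act_congr {m n : ℕ} (D : Diagram m n) {ψ φ : List Bool → ℂ}
    (h : ∀ w, w.length = m → ψ w = φ w) {w : List Bool} (hw : w.length = n) :
    D.act s z ψ w = D.act s z φ w := by
  induction D generalizing ψ φ w with
  | idn n => exact h w hw
  | piece e p q hm hn =>
    obtain ⟨a, o, b, rfl, ha, ho, hb⟩ := exists_append_of_length (hw.trans hn)
    simp only [Diagram.act, pieceAct_append s e b _ ha ho]
    refine Finset.sum_congr rfl fun i hi => ?_
    rw [h]
    simp only [List.length_append, Piece.length_of_mem_inputs hi]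
    omega
  | rot n =>
    cases w with
    | nil => simp at hw
    | cons x w =>
      simp only [Diagram.act, rotAct_cons]
      rw [h]
      simpa using hw
  | rotInv n =>
    rcases w.eq_nil_or_concat' with rfl | ⟨w, x, rfl⟩
    · simp at hw
    · simp only [Diagram.act, rotInvAct_append]
      rw [h]
      simpa using hw
  | comp D E ihD ihE => exact ihE (fun w hw => ihD h hw) hw

section local_formulas

variable {p : ℕ} {a : List Bool} (h : a.length = p) (x y t : Bool) (b : List Bool)
  (ψ : List Bool → ℂ)

include h

theorem capAct_append : pieceAct s .cap p ψ (a ++ b) =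
    -s * ψ (a ++ true :: false :: b) + (s : ℂ)⁻¹ * ψ (a ++ false :: true :: b) := by
  have := pieceAct_append s .cap (o := []) b ψ h rfl
  simpa [Piece.inputs, Piece.weight, capWeight] using this

theorem cupAct_append : pieceAct s .cup p ψ (a ++ x :: y :: b) = cupWeight s x y * ψ (a ++ b) := by
  have := pieceAct_append s .cup (o := [x, y]) b ψ h rfl
  simpa [Piece.inputs, Piece.weight] using this

theorem posAct_append : pieceAct s .pos p ψ (a ++ x :: y :: b) =
    s * ψ (a ++ x :: y :: b) + (s : ℂ)⁻¹ * (cupWeight s x y *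
      (-s * ψ (a ++ true :: false :: b) + (s : ℂ)⁻¹ * ψ (a ++ false :: true :: b))) := by
  have := pieceAct_append s .pos (o := [x, y]) b ψ h rfl
  have hs : (s : ℂ) ≠ 0 := s.ne_zero
  refine Eq.trans (by simpa using this) ?_
  cases x <;> cases y <;> simp [Piece.inputs, Piece.weight, capWeight, cupWeight] <;>
    field_simp <;> ring

theorem negAct_append : pieceAct s .neg p ψ (a ++ x :: y :: b) =
    (s : ℂ)⁻¹ * ψ (a ++ x :: y :: b) + s * (cupWeight s x y *
      (-s * ψ (a ++ true :: false :: b) + (s : ℂ)⁻¹ * ψ (a ++ false :: true :: b))) := by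
  have := pieceAct_append s .neg (o := [x, y]) b ψ h rfl
  have hs : (s : ℂ) ≠ 0 := s.ne_zero
  refine Eq.trans (by simpa using this) ?_
  cases x <;> cases y <;> simp [Piece.inputs, Piece.weight, capWeight, cupWeight] <;>
    field_simp <;> ring

theorem capAct_append_succ : pieceAct s .cap (p + 1) ψ (a ++ x :: b) =
    -s * ψ (a ++ x :: true :: false :: b) + (s : ℂ)⁻¹ * ψ (a ++ x :: false :: true :: b) := by
  simpa using capAct_append (s := s) (a := a ++ [x]) (p := p + 1) (by simp [h]) b ψ

theorem cupAct_append_succ : pieceAct s .cup (p + 1) ψ (a ++ t :: x :: y :: b) =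
    cupWeight s x y * ψ (a ++ t :: b) := by
  simpa using cupAct_append (s := s) (a := a ++ [t]) (p := p + 1) (by simp [h]) x y b ψ

theorem posAct_append_succ : pieceAct s .pos (p + 1) ψ (a ++ t :: x :: y :: b) =
    s * ψ (a ++ t :: x :: y :: b) + (s : ℂ)⁻¹ * (cupWeight s x y *
      (-s * ψ (a ++ t :: true :: false :: b) +
        (s : ℂ)⁻¹ * ψ (a ++ t :: false :: true :: b))) := by
  simpa using posAct_append (s := s) (a := a ++ [t]) (p := p + 1) (by simp [h]) x y b ψ

theorem negAct_append_succ : pieceAct s .neg (p + 1) ψ (a ++ t :: x :: y :: b) =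
    (s : ℂ)⁻¹ * ψ (a ++ t :: x :: y :: b) + s * (cupWeight s x y *
      (-s * ψ (a ++ t :: true :: false :: b) +
        (s : ℂ)⁻¹ * ψ (a ++ t :: false :: true :: b))) := by
  simpa using negAct_append (s := s) (a := a ++ [t]) (p := p + 1) (by simp [h]) x y b ψ

end local_formulas

/-- Conservation of spin: nonzero weights occur only when the inner and outer configurations have
the same total spin, and the product of the twists is `z` to that total. This is what allows a piece
to pass through the seam. -/
theorem Piece.weight_mul_twist (e : Piece) {i o : List Bool} (hi : i ∈ e.inputs)
    (ho : o.length = e.tgt) :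
    e.weight s i o * (o.map (twist z)).prod = (i.map (twist z)).prod * e.weight s i o := by
  have hz : (z : ℂ) ≠ 0 := z.ne_zero
  cases e with
  | cap =>
    obtain rfl := List.length_eq_zero_iff.1 ho
    simp only [Piece.inputs, Finset.mem_insert, Finset.mem_singleton] at hi
    rcases hi with rfl | rfl | rfl | rfl <;> simp [Piece.weight, twist, capWeight]
  | cup =>
    obtain ⟨x, y, rfl⟩ := List.length_eq_two.1 ho
    simp only [Piece.inputs, Finset.mem_singleton] at hi
    subst hi
    cases x <;> cases y <;> simp [Piece.weight, twist, cupWeight]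
  | pos =>
    obtain ⟨x, y, rfl⟩ := List.length_eq_two.1 ho
    simp only [Piece.inputs, Finset.mem_insert, Finset.mem_singleton] at hi
    rcases hi with rfl | rfl | rfl | rfl <;> cases x <;> cases y <;>
      simp [Piece.weight, twist, cupWeight, capWeight, hz, mul_comm]
  | neg =>
    obtain ⟨x, y, rfl⟩ := List.length_eq_two.1 ho
    simp only [Piece.inputs, Finset.mem_insert, Finset.mem_singleton] at hi
    rcases hi with rfl | rfl | rfl | rfl <;> cases x <;> cases y <;>
      simp [Piece.weight, twist, cupWeight, capWeight, hz, mul_comm]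

theorem pieceAct_interchange (e e' : Piece) (p q r : ℕ) (ψ : List Bool → ℂ) {w : List Bool}
    (hw : w.length = p + e.tgt + q + e'.tgt + r) :
    pieceAct s e' (p + e.tgt + q) (pieceAct s e p ψ) w =
      pieceAct s e p (pieceAct s e' (p + e.src + q) ψ) w := by
  obtain ⟨c, o', b, rfl, hc, ho', -⟩ := exists_append_of_length hw
  obtain ⟨a, o, d, rfl, ha, ho, hd⟩ := exists_append_of_length hc
  rw [pieceAct_append s e' _ _ hc ho']
  simp only [List.append_assoc]
  rw [pieceAct_append s e _ _ ha ho]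
  simp only [pieceAct_append s e _ _ ha ho]
  have H : ∀ i ∈ e.inputs, pieceAct s e' (p + e.src + q) ψ (a ++ (i ++ (d ++ (o' ++ b)))) =
      ∑ i' ∈ e'.inputs, e'.weight s i' o' * ψ (a ++ (i ++ (d ++ (i' ++ b)))) := by
    intro i hi
    have := pieceAct_append s e' (a := a ++ (i ++ d)) (p := p + e.src + q) b ψ
      (by simp [Piece.length_of_mem_inputs hi, ha, hd]; omega) ho'
    simpa only [List.append_assoc] using this
  refine Eq.trans ?_ (Finset.sum_congr rfl fun i hi => by rw [H i hi]).symm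
  simp only [Finset.mul_sum]
  rw [Finset.sum_comm]
  exact Finset.sum_congr rfl fun i _ => Finset.sum_congr rfl fun i' _ => by ring

theorem pieceAct_rot (e : Piece) (p q : ℕ) (ψ : List Bool → ℂ) {w : List Bool}
    (hw : w.length = p + e.tgt + q + 1) :
    rotAct z (pieceAct s e p ψ) w = pieceAct s e (p + 1) (rotAct z ψ) w := by
  cases w with
  | nil => simp at hw
  | cons x w =>
    obtain ⟨a, o, b, rfl, ha, ho, -⟩ := exists_append_of_length (p := p) (t := e.tgt) (q := q)
      (by simpa using hw)
    rw [rotAct_cons, ← List.cons_append, pieceAct_append s e _ _ (by simp [ha]) ho,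
      List.append_assoc, List.append_assoc, pieceAct_append s e _ _ ha ho, Finset.mul_sum]
    refine Finset.sum_congr rfl fun i _ => ?_
    rw [List.cons_append, rotAct_cons]
    simp only [List.append_assoc]
    ring

theorem rotAct_rotAct (x y : Bool) (w : List Bool) (ψ : List Bool → ℂ) :
    rotAct z (rotAct z ψ) (x :: y :: w) = twist z x * (twist z y * ψ (w ++ [x, y])) := by
  rw [rotAct_cons, List.cons_append, rotAct_cons]
  simp

theorem pieceAct_rot_rot (e : Piece) (hs : e.src = 2) (ht : e.tgt = 2) (p : ℕ) (ψ : List Bool → ℂ)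
    {w : List Bool} (hw : w.length = p + 2) :
    rotAct z (rotAct z (pieceAct s e p ψ)) w = pieceAct s e 0 (rotAct z (rotAct z ψ)) w := by
  obtain ⟨x, y, a, rfl⟩ : ∃ x y a, w = x :: y :: a := by
    match w, hw with
    | x :: y :: a, _ => exact ⟨x, y, a, rfl⟩
  have ha : a.length = p := by simpa using hw
  rw [rotAct_rotAct]
  have h₁ := pieceAct_append s e (a := a) (o := [x, y]) [] ψ ha (by simp [ht])
  have h₂ := pieceAct_append s e (p := 0) (a := []) (o := [x, y]) a (rotAct z (rotAct z ψ)) rfl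
    (by simp [ht])
  simp only [List.append_nil] at h₁
  simp only [List.nil_append, List.cons_append] at h₂
  rw [h₁, h₂, Finset.mul_sum, Finset.mul_sum]
  refine Finset.sum_congr rfl fun i hi => ?_
  obtain ⟨x', y', rfl⟩ := List.length_eq_two.1 ((Piece.length_of_mem_inputs hi).trans hs)
  have h₃ := e.weight_mul_twist (s := s) (z := z) hi (o := [x, y]) (by simp [ht])
  simp only [List.map_cons, List.map_nil, List.prod_cons, List.prod_nil, mul_one] at h₃
  rw [List.cons_append, List.cons_append, List.nil_append, rotAct_rotAct]
  -- Both sides differ only in whether the twists are read off the outer or the inner pair of spins.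
  linear_combination ψ (a ++ [x', y']) * h₃

/-- Moves away from the seam are finite checks on the spins of the strands involved. Moves through
the seam hold because both ends of a cup or cap carry opposite spins, so their twists cancel, or by
conservation of spin for crossings. -/
theorem Diagram.act_eq_of_isotopy {m n : ℕ} {D E : Diagram m n} (h : PlanarIsotopy D E)
    (ψ : List Bool → ℂ) {w : List Bool} (hw : w.length = n) :
    D.act s z ψ w = E.act s z ψ w := by
  have hs : (s : ℂ) ≠ 0 := s.ne_zero
  have hz : (z : ℂ) ≠ 0 := z.ne_zero
  have three {p q : ℕ} {w : List Bool} (hw : w.length = p + q + 1) :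
      ∃ a x b, w = a ++ x :: b ∧ a.length = p := by
    obtain ⟨a, o, b, rfl, ha, ho, -⟩ := exists_append_of_length (w := w) (p := p) (t := 1) (q := q)
      (by omega)
    obtain ⟨x, rfl⟩ := List.length_eq_one_iff.1 ho
    exact ⟨a, x, b, rfl, ha⟩
  have five {p q : ℕ} {w : List Bool} (hw : w.length = p + q + 3) :
      ∃ a x y t b, w = a ++ x :: y :: t :: b ∧ a.length = p := by
    obtain ⟨a, o, b, rfl, ha, ho, -⟩ := exists_append_of_length (w := w) (p := p) (t := 3) (q := q)
      (by omega)
    obtain ⟨x, y, t, rfl⟩ := List.length_eq_three.1 ho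
    exact ⟨a, x, y, t, b, rfl, ha⟩
  induction h generalizing ψ w with
  | refl D => rfl
  | symm _ ih => exact (ih ψ hw).symm
  | trans _ _ ih₁ ih₂ => exact (ih₁ ψ hw).trans (ih₂ ψ hw)
  -- The inner images agree only on words of length `m`; locality of `E₂` makes that sufficient.
  | @congr k m n D₁ D₂ E₁ E₂ _ _ ih₁ ih₂ =>
    exact (ih₂ _ hw).trans (E₂.act_congr (fun w hw => ih₁ ψ hw) hw)
  | id_comp D => rfl
  | comp_id D => rfl
  | assoc D E F => rfl
  | interchange e e' p q r hm hk hk' hn =>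
    exact pieceAct_interchange e e' p q r ψ (hw.trans hn)
  | zigzag p q =>
    obtain ⟨a, x, b, rfl, ha⟩ := three hw
    simp only [Diagram.act, LinearMap.comp_apply, LinearMap.id_apply, capAct_append_succ ha,
      cupAct_append ha]
    cases x <;> simp [cupWeight, hs]
  | zagzig p q =>
    obtain ⟨a, x, b, rfl, ha⟩ := three hw
    simp only [Diagram.act, LinearMap.comp_apply, LinearMap.id_apply, capAct_append ha,
      cupAct_append_succ ha]
    cases x <;> simp [cupWeight, hs]
  | pos_cap p q =>
    obtain ⟨a, x, b, rfl, ha⟩ := three hw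
    simp only [Diagram.act, LinearMap.comp_apply, capAct_append ha, capAct_append_succ ha,
      posAct_append ha, negAct_append_succ ha]
    cases x <;> simp [cupWeight] <;> field_simp <;> ring
  | neg_cap p q =>
    obtain ⟨a, x, b, rfl, ha⟩ := three hw
    simp only [Diagram.act, LinearMap.comp_apply, capAct_append ha, capAct_append_succ ha,
      negAct_append ha, posAct_append_succ ha]
    cases x <;> simp [cupWeight] <;> field_simp <;> ring
  | cup_pos p q =>
    obtain ⟨a, x, y, t, b, rfl, ha⟩ := five hw
    simp only [Diagram.act, LinearMap.comp_apply, cupAct_append ha, cupAct_append_succ ha,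
      posAct_append ha, negAct_append_succ ha]
    cases x <;> cases y <;> cases t <;> simp [cupWeight, hs, add_comm]
  | cup_neg p q =>
    obtain ⟨a, x, y, t, b, rfl, ha⟩ := five hw
    simp only [Diagram.act, LinearMap.comp_apply, cupAct_append ha, cupAct_append_succ ha,
      negAct_append ha, posAct_append_succ ha]
    cases x <;> cases y <;> cases t <;> simp [cupWeight, hs, add_comm]
  | rot_rotInv n =>
    rcases w.eq_nil_or_concat' with rfl | ⟨w, x, rfl⟩
    · simp at hw
    · simp only [Diagram.act, LinearMap.comp_apply, LinearMap.id_apply, rotInvAct_append,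
        rotAct_cons]
      rw [inv_mul_cancel_left₀ (twist_ne_zero z x)]
  | rotInv_rot n =>
    cases w with
    | nil => simp at hw
    | cons x w =>
      simp only [Diagram.act, LinearMap.comp_apply, LinearMap.id_apply, rotInvAct_append,
        rotAct_cons]
      rw [mul_inv_cancel_left₀ (twist_ne_zero z x)]
  | piece_rot e p q => exact pieceAct_rot e p q ψ hw
  | cup_rot_rot p =>
    obtain ⟨x, y, a, rfl⟩ : ∃ x y a, w = x :: y :: a := by
      match w, hw with
      | x :: y :: a, _ => exact ⟨x, y, a, rfl⟩
    have ha : a.length = p := by simpa using hw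
    have h₁ := cupAct_append (s := s) ha x y [] ψ
    have h₂ := cupAct_append (s := s) (p := 0) (a := []) rfl x y a ψ
    simp only [List.append_nil, List.nil_append] at h₁ h₂
    simp only [Diagram.act, LinearMap.comp_apply, rotAct_rotAct, h₁, h₂]
    cases x <;> cases y <;> simp [cupWeight, twist, hz]
  | rot_rot_cap p =>
    have h₁ := capAct_append (s := s) (a := w) hw [] ψ
    have h₂ := capAct_append (s := s) (p := 0) (a := []) rfl w (rotAct z (rotAct z ψ))
    simp only [List.append_nil, List.nil_append] at h₁ h₂
    simp only [Diagram.act, LinearMap.comp_apply, rotAct_rotAct, h₁, h₂]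
    simp [twist, hz]
  | pos_rot_rot p => exact pieceAct_rot_rot .pos rfl rfl p ψ hw
  | neg_rot_rot p => exact pieceAct_rot_rot .neg rfl rfl p ψ hw

/-! ### Descent of the spin action to the skein category -/

/-- Restriction of a function to the spin configurations of length `n`. -/
def trunc (n : ℕ) : (List Bool → ℂ) →ₗ[ℂ] (List Bool → ℂ) where
  toFun ψ w := if w.length = n then ψ w else 0
  map_add' ψ φ := by ext w; by_cases h : w.length = n <;> simp [h]
  map_smul' c ψ := by ext w; by_cases h : w.length = n <;> simp [h]

theorem trunc_apply {n : ℕ} {w : List Bool} (hw : w.length = n) (ψ : List Bool → ℂ) :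
    trunc n ψ w = ψ w := if_pos hw

theorem trunc_ext {n : ℕ} {ψ φ : List Bool → ℂ} (h : ∀ w, w.length = n → ψ w = φ w) :
    trunc n ψ = trunc n φ := by
  ext w
  by_cases hw : w.length = n
  · rw [trunc_apply hw, trunc_apply hw, h w hw]
  · exact (if_neg hw).trans (if_neg hw).symm

theorem trunc_act_trunc {m n : ℕ} (D : Diagram m n) (ψ : List Bool → ℂ) :
    trunc n (D.act s z (trunc m ψ)) = trunc n (D.act s z ψ) :=
  trunc_ext fun _ hw => D.act_congr (fun _ h => trunc_apply h ψ) hw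

variable (s z)

/-- The operator of a tangle diagram on spin configurations. -/
def Tangle.spin {m n : ℕ} (D : Tangle m n) : (List Bool → ℂ) →ₗ[ℂ] (List Bool → ℂ) :=
  Quot.lift (fun E : Diagram m n => trunc n ∘ₗ E.act s z)
    (fun _ _ h => LinearMap.ext fun ψ => trunc_ext fun _ hw => act_eq_of_isotopy h ψ hw) D

theorem Tangle.spin_cls {m n : ℕ} (D : Diagram m n) :
    D.cls.spin s z = trunc n ∘ₗ D.act s z := rfl

theorem Tangle.spin_comp {k m n : ℕ} (D : Tangle k m) (E : Tangle m n) :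
    (D.comp E).spin s z = E.spin s z ∘ₗ D.spin s z := by
  induction D using Quot.ind with | _ D
  induction E using Quot.ind with | _ E
  exact LinearMap.ext fun ψ => (trunc_act_trunc E (D.act s z ψ)).symm

theorem Tangle.spin_id_comp {m n : ℕ} (D : Tangle m n) :
    D.spin s z ∘ₗ trunc m = D.spin s z := by
  induction D using Quot.ind with | _ D
  exact LinearMap.ext fun ψ => trunc_act_trunc D ψ

/-- The crossing weights are the Kauffman expansion by definition, and the cup and cap weights pair
to `(-s) s + s⁻¹ (-s⁻¹) = -(s² + s⁻²)`, the value of a contractible loop. Truncation plays the part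
of the identity diagram. -/
theorem skeinIdeal_le_ker_spin (m n : ℕ) : skeinIdeal s m n ≤
    LinearMap.ker (Finsupp.linearCombination ℂ fun D : Tangle m n => D.spin s z) := by
  have hs : (s : ℂ) ≠ 0 := s.ne_zero
  have two {p q k : ℕ} (hk : k = p + 2 + q) {w : List Bool} (hw : w.length = k) :
      ∃ a x y b, w = a ++ x :: y :: b ∧ a.length = p := by
    obtain ⟨a, o, b, rfl, ha, ho, -⟩ := exists_append_of_length (w := w) (p := p) (t := 2) (q := q)
      (by omega)
    obtain ⟨x, y, rfl⟩ := List.length_eq_two.1 ho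
    exact ⟨a, x, y, b, rfl, ha⟩
  refine Submodule.span_le.2 ?_
  intro x (hx : SkeinRelator s x)
  rw [SetLike.mem_coe, LinearMap.mem_ker]
  cases hx with
  | @kauffman_pos k l p q hk hl F G =>
    have h : (pos p q hk hk).cls.spin s z = (s : ℂ) • trunc k + ((s⁻¹ : ℂˣ) : ℂ) •
        (comp (cap p q hk hl : Diagram k l) (cup p q hl hk)).cls.spin s z := by
      refine LinearMap.ext fun ψ => ?_
      simp only [Tangle.spin_cls, LinearMap.add_apply, LinearMap.smul_apply, LinearMap.comp_apply]
      rw [← map_smul (trunc k), ← map_smul (trunc k), ← map_add]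
      refine trunc_ext fun w hw => ?_
      obtain ⟨a, x, y, b, rfl, ha⟩ := two hk hw
      simp only [Diagram.act, LinearMap.comp_apply, posAct_append ha, Pi.add_apply, Pi.smul_apply,
        cupAct_append ha, capAct_append ha, smul_eq_mul, Units.val_inv_eq_inv_val]
    simp only [map_sub, map_add, map_smul, basis, Finsupp.linearCombination_single, one_smul,
      Tangle.spin_comp, h]
    rw [LinearMap.add_comp, LinearMap.comp_add, LinearMap.smul_comp, LinearMap.smul_comp,
      LinearMap.comp_smul, LinearMap.comp_smul, ← LinearMap.comp_assoc, Tangle.spin_id_comp,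
      sub_self]
  | @kauffman_neg k l p q hk hl F G =>
    have h : (neg p q hk hk).cls.spin s z = (s : ℂ) •
        (comp (cap p q hk hl : Diagram k l) (cup p q hl hk)).cls.spin s z +
          ((s⁻¹ : ℂˣ) : ℂ) • trunc k := by
      refine LinearMap.ext fun ψ => ?_
      simp only [Tangle.spin_cls, LinearMap.add_apply, LinearMap.smul_apply, LinearMap.comp_apply]
      rw [← map_smul (trunc k), ← map_smul (trunc k), ← map_add]
      refine trunc_ext fun w hw => ?_
      obtain ⟨a, x, y, b, rfl, ha⟩ := two hk hw
      simp only [Diagram.act, LinearMap.comp_apply, negAct_append ha, Pi.add_apply, Pi.smul_apply,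
        cupAct_append ha, capAct_append ha, smul_eq_mul, Units.val_inv_eq_inv_val]
      ring
    simp only [map_sub, map_add, map_smul, basis, Finsupp.linearCombination_single, one_smul,
      Tangle.spin_comp, h]
    rw [LinearMap.add_comp, LinearMap.comp_add, LinearMap.smul_comp, LinearMap.smul_comp,
      LinearMap.comp_smul, LinearMap.comp_smul, ← LinearMap.comp_assoc _ (trunc k),
      Tangle.spin_id_comp, sub_self]
  | @loop_removal k l p q hk hl F G =>
    have h : (comp (cup p q hl hk : Diagram l k) (cap p q hk hl)).cls.spin s z =
        (-((s : ℂ) ^ 2 + ((s⁻¹ : ℂˣ) : ℂ) ^ 2)) • trunc l := by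
      refine LinearMap.ext fun ψ => ?_
      simp only [Tangle.spin_cls, LinearMap.smul_apply, LinearMap.comp_apply]
      rw [← map_smul]
      refine trunc_ext fun w hw => ?_
      obtain ⟨a, o, b, rfl, ha, ho, -⟩ := exists_append_of_length (w := w) (p := p) (t := 0) (q := q)
        (by omega)
      simp only [Diagram.act, LinearMap.comp_apply, Pi.smul_apply, capAct_append ha,
        cupAct_append ha, smul_eq_mul, Units.val_inv_eq_inv_val, cupWeight]
      ring
    simp only [map_sub, map_smul, basis, Finsupp.linearCombination_single, one_smul,
      Tangle.spin_comp, h]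
    rw [LinearMap.smul_comp, LinearMap.comp_smul, ← LinearMap.comp_assoc, Tangle.spin_id_comp,
      sub_self]

/-- The twisted spin chain representation of the skein category. -/
def spin {m n : ℕ} : (obj s m ⟶ obj s n) →ₗ[ℂ] (List Bool → ℂ) →ₗ[ℂ] (List Bool → ℂ) :=
  (skeinIdeal s m n).liftQ (Finsupp.linearCombination ℂ fun D : Tangle m n => D.spin s z)
    (skeinIdeal_le_ker_spin s z m n)

theorem spin_skein_cls {m n : ℕ} (D : Tangle m n) : spin s z (D.skein s) = D.spin s z := by
  rw [spin, Tangle.skein, Submodule.mkQ_apply]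
  erw [Submodule.liftQ_apply]
  rw [Finsupp.linearCombination_single, one_smul]

theorem spin_skein {m n : ℕ} (D : Diagram m n) (ψ : List Bool → ℂ) {w : List Bool}
    (hw : w.length = n) : spin s z (skein s D) ψ w = D.act s z ψ w := by
  rw [show spin s z (skein s D) = _ from spin_skein_cls s z D.cls]
  exact trunc_apply hw _

theorem spin_comp {k m n : ℕ} (f : obj s k ⟶ obj s m) (g : obj s m ⟶ obj s n) :
    spin s z (f ≫ g) = spin s z g ∘ₗ spin s z f := by
  have H : (SkeinHom.comp s k m n).compr₂ (spin s z) =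
      (LinearMap.lcomp ℂ _ (spin s z)).comp
        ((LinearMap.llcomp ℂ (List Bool → ℂ) (List Bool → ℂ) (List Bool → ℂ)).flip ∘ₗ
          (spin s z : (obj s k ⟶ obj s m) →ₗ[ℂ] _)) :=
    SkeinHom.ext fun D => SkeinHom.ext fun E => by
      change spin s z (SkeinHom.comp s k m n (D.skein s) (E.skein s)) =
        spin s z (E.skein s) ∘ₗ spin s z (D.skein s)
      rw [SkeinHom.comp_skein, spin_skein_cls, spin_skein_cls, spin_skein_cls, Tangle.spin_comp]
  exact LinearMap.congr_fun (LinearMap.congr_fun H f) g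

theorem spin_congr {m n : ℕ} (f : obj s m ⟶ obj s n) {ψ φ : List Bool → ℂ}
    (h : ∀ w, w.length = m → ψ w = φ w) : spin s z f ψ = spin s z f φ := by
  rw [← Category.id_comp f, spin_comp, LinearMap.comp_apply, LinearMap.comp_apply]
  congr 1
  rw [← skein_idn, show spin s z (skein s (idn m)) = _ from spin_skein_cls s z (idn m).cls]
  exact trunc_ext h

end spin

/-! ## The modules `V_n(u)` and `V_n(v)` -/

section even

variable {n : ℕ} {u : ℂ}

theorem poly_X_smul (f : obj s 0 ⟶ obj s n) : (Polynomial.X : Polynomial ℂ) • f = ncLoop s ≫ f := by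
  rw [poly_smul_def, Polynomial.aeval_X, MulOpposite.unop_op]

theorem poly_C_smul (c : ℂ) (f : obj s 0 ⟶ obj s n) : (Polynomial.C c) • f = c • f := by
  rw [poly_smul_def, Polynomial.aeval_C, Algebra.algebraMap_eq_smul_one, MulOpposite.unop_smul,
    MulOpposite.unop_one, Linear.smul_comp]
  exact congrArg (c • ·) (Category.id_comp f)

theorem C₀_smul_def (p : Polynomial ℂ) (c : C₀ u) :
    p • c = (show C₀ u from p.eval u * (show ℂ from c)) := rfl

/-- A scalar is a constant polynomial, so it can be moved across the tensor sign. Hence every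
element of the module has the form `f ⊗ 1`. -/
theorem VEven.tmul_eq (f : obj s 0 ⟶ obj s n) (c : ℂ) :
    f ⊗ₜ[Polynomial ℂ] (show C₀ u from c) = c • VEven.mk s u f := by
  have h : (show C₀ u from c) = Polynomial.C c • (show C₀ u from (1 : ℂ)) := by
    rw [C₀_smul_def, Polynomial.eval_C]
    exact (mul_one c).symm
  refine (congrArg (f ⊗ₜ[Polynomial ℂ] ·) h).trans ?_
  rw [← TensorProduct.smul_tmul, poly_C_smul]
  rfl

theorem VEven.mk_add (f g : obj s 0 ⟶ obj s n) :
    VEven.mk s u (f + g) = VEven.mk s u f + VEven.mk s u g := TensorProduct.add_tmul _ _ _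

theorem VEven.mk_smul (c : ℂ) (f : obj s 0 ⟶ obj s n) :
    VEven.mk s u (c • f) = c • VEven.mk s u f := rfl

theorem VEven.mk_poly_smul (p : Polynomial ℂ) (f : obj s 0 ⟶ obj s n) :
    VEven.mk s u (p • f) = p.eval u • VEven.mk s u f := by
  rw [VEven.mk, TensorProduct.smul_tmul, C₀_smul_def]
  exact (VEven.tmul_eq f (p.eval u * 1)).trans (by rw [mul_one])

theorem VEven.mk_surjective (x : VEven s n u) : ∃ f, x = VEven.mk s u f := by
  induction x using TensorProduct.induction_on with
  | zero => exact ⟨0, (TensorProduct.zero_tmul _ _).symm⟩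
  | tmul f c => exact ⟨(show ℂ from c) • f, VEven.tmul_eq f c⟩
  | add x y hx hy =>
    obtain ⟨f, rfl⟩ := hx
    obtain ⟨g, rfl⟩ := hy
    exact ⟨f + g, (VEven.mk_add f g).symm⟩

theorem VEven.smul_mk (a : TL s n) (f : obj s 0 ⟶ obj s n) :
    a • VEven.mk s u f = VEven.mk s u (f ≫ a) := rfl

/-- A functional on `V_n(u)` from one on `Hom(0, n)`. -/
def VEven.functional (L : (obj s 0 ⟶ obj s n) →ₗ[Polynomial ℂ] C₀ u) : VEven s n u →ₗ[ℂ] ℂ where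
  -- The functional is `f ⊗ c ↦ L(f) c`. It is built as a balanced biadditive map because the tensor
  -- product is over `ℂ[X]` while the target is a bare `ℂ`; linearity over `ℂ` is then checked on
  -- elements `f ⊗ 1`.
  toFun := TensorProduct.liftAddHom (P := ℂ)
    ((show C₀ u →+ C₀ u →+ ℂ from AddMonoidHom.mul (R := ℂ)).comp L.toAddMonoidHom)
    fun r f c => by
      change (show ℂ from L (r • f)) * (show ℂ from c) = (show ℂ from L f) * (r.eval u * (show ℂ from c))
      rw [map_smul, C₀_smul_def]
      exact (mul_left_comm _ _ _).trans (mul_assoc _ _ _).symm |>.symm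
  map_add' := map_add _
  map_smul' c x := by
    obtain ⟨f, rfl⟩ := VEven.mk_surjective x
    rw [← VEven.mk_smul]
    change (show ℂ from L (c • f)) * (1 : ℂ) = c * ((show ℂ from L f) * (1 : ℂ))
    rw [← poly_C_smul, map_smul, C₀_smul_def, Polynomial.eval_C]
    exact mul_assoc _ _ _

theorem VEven.functional_mk (L : (obj s 0 ⟶ obj s n) →ₗ[Polynomial ℂ] C₀ u)
    (f : obj s 0 ⟶ obj s n) : VEven.functional L (VEven.mk s u f) = (show ℂ from L f) :=
  mul_one (show ℂ from L f)

theorem exists_poly_smul (f : obj s 0 ⟶ obj s 0) :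
    ∃ p : Polynomial ℂ, f = p • 𝟙 (obj s 0) := by
  have hf : f ∈ Submodule.span ℂ (Set.range fun k : ℕ => (ncLoop s ^ k : TL s 0)) := by
    rw [span_ncLoop_pow]; trivial
  induction hf using Submodule.span_induction with
  | mem x h =>
    obtain ⟨k, rfl⟩ := h
    refine ⟨Polynomial.X ^ k, ?_⟩
    rw [poly_smul_def, map_pow, Polynomial.aeval_X, ← MulOpposite.op_pow, MulOpposite.unop_op]
    exact (Category.comp_id _).symm
  | zero => exact ⟨0, (zero_smul _ _).symm⟩
  | add x y _ _ hx hy =>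
    obtain ⟨p, rfl⟩ := hx
    obtain ⟨q, rfl⟩ := hy
    exact ⟨p + q, (add_smul _ _ _).symm⟩
  | smul c x _ hx =>
    obtain ⟨p, rfl⟩ := hx
    exact ⟨Polynomial.C c * p, by rw [mul_smul, poly_C_smul]⟩

theorem poly_smul_comp {k : ℕ} (p : Polynomial ℂ) (f : obj s 0 ⟶ obj s n) (g : obj s n ⟶ obj s k) :
    (p • f) ≫ g = p • (f ≫ g) := by
  rw [poly_smul_def, poly_smul_def, Category.assoc]

theorem exists_poly_smul_cPlus_add (f : obj s 0 ⟶ obj s 2) :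
    ∃ p q : Polynomial ℂ, f = p • cPlus s + q • cMinus s := by
  obtain ⟨x, y, rfl⟩ := exists_eq_comp_cPlus_add_comp_cMinus f
  obtain ⟨p, rfl⟩ := exists_poly_smul x
  obtain ⟨q, rfl⟩ := exists_poly_smul y
  exact ⟨p, q, by rw [poly_smul_comp, poly_smul_comp, Category.id_comp, Category.id_comp]⟩

end even

section odd

variable {n : ℕ} {v : ℂˣ}

theorem laurent_C_mul_T_smul (c : ℂ) (k : ℤ) (f : obj s 1 ⟶ obj s n) :
    (LaurentPolynomial.C c * LaurentPolynomial.T k) • f =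
      c • (((rho s ^ k : (TL s 1)ˣ) : TL s 1) ≫ f) := by
  rw [← LaurentPolynomial.single_eq_C_mul_T]
  change (AddMonoidAlgebra.lift ℂ (TL s 1)ᵐᵒᵖ ℤ ((Units.coeHom (TL s 1)ᵐᵒᵖ).comp
      (zpowersHom (TL s 1)ᵐᵒᵖˣ (Units.opEquiv.symm (MulOpposite.op (rho s)))))
        (AddMonoidAlgebra.single k c)).unop ≫ f = _
  rw [AddMonoidAlgebra.lift_single, MulOpposite.unop_smul, Linear.smul_comp]
  congr 2
  simp [zpowersHom_apply, ← map_zpow]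

theorem laurent_T_smul (k : ℤ) (f : obj s 1 ⟶ obj s n) :
    (LaurentPolynomial.T k : LaurentPolynomial ℂ) • f = ((rho s ^ k : (TL s 1)ˣ) : TL s 1) ≫ f := by
  have := laurent_C_mul_T_smul 1 k f
  rwa [map_one, one_mul, one_smul] at this

theorem laurent_C_smul (c : ℂ) (f : obj s 1 ⟶ obj s n) :
    (LaurentPolynomial.C c) • f = c • f := by
  have := laurent_C_mul_T_smul c 0 f
  rw [LaurentPolynomial.T_zero, mul_one, zpow_zero] at this
  exact this.trans (congrArg (c • ·) (Category.id_comp f))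

theorem C₁_smul_def (p : LaurentPolynomial ℂ) (c : C₁ v) :
    p • c = (show C₁ v from LaurentPolynomial.eval₂ (RingHom.id ℂ) v p * (show ℂ from c)) := rfl

theorem VOdd.tmul_eq (f : obj s 1 ⟶ obj s n) (c : ℂ) :
    f ⊗ₜ[LaurentPolynomial ℂ] (show C₁ v from c) = c • VOdd.mk s v f := by
  have h : (show C₁ v from c) = LaurentPolynomial.C c • (show C₁ v from (1 : ℂ)) := by
    rw [C₁_smul_def, LaurentPolynomial.eval₂_C]
    exact (mul_one c).symm
  refine (congrArg (f ⊗ₜ[LaurentPolynomial ℂ] ·) h).trans ?_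
  rw [← TensorProduct.smul_tmul, laurent_C_smul]
  rfl

theorem VOdd.mk_add (f g : obj s 1 ⟶ obj s n) :
    VOdd.mk s v (f + g) = VOdd.mk s v f + VOdd.mk s v g := TensorProduct.add_tmul _ _ _

theorem VOdd.mk_smul (c : ℂ) (f : obj s 1 ⟶ obj s n) :
    VOdd.mk s v (c • f) = c • VOdd.mk s v f := rfl

theorem VOdd.mk_laurent_smul (p : LaurentPolynomial ℂ) (f : obj s 1 ⟶ obj s n) :
    VOdd.mk s v (p • f) = LaurentPolynomial.eval₂ (RingHom.id ℂ) v p • VOdd.mk s v f := by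
  rw [VOdd.mk, TensorProduct.smul_tmul, C₁_smul_def]
  exact (VOdd.tmul_eq f (LaurentPolynomial.eval₂ (RingHom.id ℂ) v p * 1)).trans
    (by rw [mul_one])

theorem VOdd.mk_surjective (x : VOdd s n v) : ∃ f, x = VOdd.mk s v f := by
  induction x using TensorProduct.induction_on with
  | zero => exact ⟨0, (TensorProduct.zero_tmul _ _).symm⟩
  | tmul f c => exact ⟨(show ℂ from c) • f, VOdd.tmul_eq f c⟩
  | add x y hx hy =>
    obtain ⟨f, rfl⟩ := hx
    obtain ⟨g, rfl⟩ := hy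
    exact ⟨f + g, (VOdd.mk_add f g).symm⟩

theorem VOdd.smul_mk (a : TL s n) (f : obj s 1 ⟶ obj s n) :
    a • VOdd.mk s v f = VOdd.mk s v (f ≫ a) := rfl

/-- A functional on `V_n(v)` from one on `Hom(1, n)`. -/
def VOdd.functional (L : (obj s 1 ⟶ obj s n) →ₗ[LaurentPolynomial ℂ] C₁ v) :
    VOdd s n v →ₗ[ℂ] ℂ where
  toFun := TensorProduct.liftAddHom (P := ℂ)
    ((show C₁ v →+ C₁ v →+ ℂ from AddMonoidHom.mul (R := ℂ)).comp L.toAddMonoidHom)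
    fun r f c => by
      change (show ℂ from L (r • f)) * (show ℂ from c) = (show ℂ from L f) *
        (LaurentPolynomial.eval₂ (RingHom.id ℂ) v r * (show ℂ from c))
      rw [map_smul, C₁_smul_def]
      exact (mul_left_comm _ _ _).trans (mul_assoc _ _ _).symm |>.symm
  map_add' := map_add _
  map_smul' c x := by
    obtain ⟨f, rfl⟩ := VOdd.mk_surjective x
    rw [← VOdd.mk_smul]
    change (show ℂ from L (c • f)) * (1 : ℂ) = c * ((show ℂ from L f) * (1 : ℂ))
    rw [← laurent_C_smul, map_smul, C₁_smul_def, LaurentPolynomial.eval₂_C]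
    exact mul_assoc _ _ _

theorem VOdd.functional_mk (L : (obj s 1 ⟶ obj s n) →ₗ[LaurentPolynomial ℂ] C₁ v)
    (f : obj s 1 ⟶ obj s n) : VOdd.functional L (VOdd.mk s v f) = (show ℂ from L f) :=
  mul_one (show ℂ from L f)

theorem exists_laurent_smul (f : obj s 1 ⟶ obj s 1) :
    ∃ p : LaurentPolynomial ℂ, f = p • 𝟙 (obj s 1) := by
  have hf : f ∈ Submodule.span ℂ
      (Set.range fun k : ℤ => ((rho s ^ k : (TL s 1)ˣ) : TL s 1)) := by
    rw [span_rho_zpow]; trivial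
  induction hf using Submodule.span_induction with
  | mem x h =>
    obtain ⟨k, rfl⟩ := h
    exact ⟨LaurentPolynomial.T k, by rw [laurent_T_smul]; exact (Category.comp_id _).symm⟩
  | zero => exact ⟨0, (zero_smul _ _).symm⟩
  | add x y _ _ hx hy =>
    obtain ⟨p, rfl⟩ := hx
    obtain ⟨q, rfl⟩ := hy
    exact ⟨p + q, (add_smul _ _ _).symm⟩
  | smul c x _ hx =>
    obtain ⟨p, rfl⟩ := hx
    exact ⟨LaurentPolynomial.C c * p, by rw [mul_smul, laurent_C_smul]⟩

end odd

/-! ## Nondegeneracy -/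

/-- `z` is a root of `z² - u z + 1`, nonzero because of the constant term. Thus every loop value `u`
is realized by some twist. -/
theorem exists_units_add_inv (u : ℂ) : ∃ z : ℂˣ, (z : ℂ) + (z : ℂ)⁻¹ = u := by
  obtain ⟨z, hz⟩ := exists_quadratic_eq_zero (a := (1 : ℂ)) (b := -u) (c := 1) one_ne_zero
    (by
      obtain ⟨w, hw⟩ := IsAlgClosed.exists_pow_nat_eq (discrim 1 (-u) 1) (n := 2) two_pos
      exact ⟨w, by rw [← hw, sq]⟩)
  have h0 : z ≠ 0 := by rintro rfl; simp at hz
  refine ⟨Units.mk0 z h0, ?_⟩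
  rw [Units.val_mk0]
  field_simp
  linear_combination hz

/-- The noncontractible loop crosses the seam once: its two spin states contribute the twists `z`
and `z⁻¹`, and in each state the cup and cap weights multiply to `1`. -/
theorem spin_ncLoop_comp (z : ℂˣ) {n : ℕ} (f : obj s 0 ⟶ obj s n) (ψ : List Bool → ℂ) :
    spin s z (ncLoop s ≫ f) ψ = ((z : ℂ) + (z : ℂ)⁻¹) • spin s z f ψ := by
  have hs : (s : ℂ) ≠ 0 := s.ne_zero
  rw [spin_comp, LinearMap.comp_apply, ← map_smul]
  refine spin_congr s z f fun w hw => ?_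
  obtain rfl := List.length_eq_zero_iff.1 hw
  rw [ncLoop, spin_skein s z (n := 0) _ _ rfl]
  have h₁ (φ : List Bool → ℂ) := capAct_append (s := s) (a := []) (p := 0) rfl [] φ
  have h₂ (x y : Bool) := cupAct_append (s := s) (a := []) (p := 0) rfl x y [] ψ
  simp only [List.nil_append] at h₁ h₂
  simp only [Diagram.act, LinearMap.comp_apply, h₁, rotAct_cons, List.cons_append, List.nil_append,
    h₂, twist, cupWeight, Pi.smul_apply, smul_eq_mul]
  field_simp

theorem spin_poly_smul (z : ℂˣ) {n : ℕ} (p : Polynomial ℂ) (f : obj s 0 ⟶ obj s n)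
    (ψ : List Bool → ℂ) :
    spin s z (p • f) ψ = p.eval ((z : ℂ) + (z : ℂ)⁻¹) • spin s z f ψ := by
  induction p using Polynomial.induction_on generalizing f with
  | C a => rw [poly_C_smul, map_smul, LinearMap.smul_apply, Polynomial.eval_C]
  | add p q hp hq =>
    rw [add_smul, map_add, LinearMap.add_apply, hp, hq, Polynomial.eval_add, add_smul]
  | monomial k a h =>
    rw [pow_succ, ← mul_assoc, mul_smul, poly_X_smul, h, spin_ncLoop_comp, smul_smul,
      Polynomial.eval_mul (q := Polynomial.X), Polynomial.eval_X]

/-- With `z + z⁻¹ = u`, the vacuum entry of the spin representation is `ℂ[X]`-linear into `ℂ_u` and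
takes the value `1` on the identity, so `V_0(u)` is not zero. -/
theorem exists_functional_VEven_zero (s : ℂˣ) (u : ℂ) :
    ∃ L : VEven s 0 u →ₗ[ℂ] ℂ, L (VEven.mk s u (𝟙 (obj s 0))) = 1 := by
  obtain ⟨z, rfl⟩ := exists_units_add_inv u
  refine ⟨VEven.functional
    { toFun := fun f => (show C₀ _ from spin s z f (fun _ => 1) [])
      map_add' := fun f g => by rw [map_add]; rfl
      map_smul' := fun p f => by rw [spin_poly_smul]; rfl }, ?_⟩
  rw [VEven.functional_mk]
  change spin s z (𝟙 (obj s 0)) (fun _ => 1) [] = 1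
  rw [← skein_idn, spin_skein s z (n := 0) _ _ rfl]
  rfl

theorem spin_cPlus (z : ℂˣ) (x y : Bool) :
    spin s z (cPlus s) (fun _ => 1) [x, y] = cupWeight s x y := by
  rw [cPlus, spin_skein s z (n := 2) _ _ rfl]
  have h₂ := cupAct_append (s := s) (a := []) (p := 0) rfl x y [] (fun _ => 1)
  simpa [Diagram.act] using h₂

theorem spin_cMinus (z : ℂˣ) (x y : Bool) :
    spin s z (cMinus s) (fun _ => 1) [x, y] = twist z x * cupWeight s y x := by
  rw [cMinus, spin_skein s z (n := 2) _ _ rfl]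
  have h₂ := cupAct_append (s := s) (a := []) (p := 0) rfl y x [] (fun _ => 1)
  simpa [Diagram.act, rotAct_cons, twist_ne_zero] using h₂

/-- Reading the relation in the spin representation at the configurations `+-` and `-+` gives two
linear equations for `p(z + z⁻¹)` and `q(z + z⁻¹)`, with determinant a unit times `z² - s⁴`. So both
polynomials vanish at all `z + z⁻¹` with `z² ≠ s⁴`, which excludes at most two values and forces
them to be zero. -/
theorem poly_eq_zero_of_smul_cPlus_add {p q : Polynomial ℂ} (h : p • cPlus s + q • cMinus s = 0) :
    p = 0 ∧ q = 0 := by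
  have hs : (s : ℂ) ≠ 0 := s.ne_zero
  have key (z : ℂˣ) : (z : ℂ) ^ 2 ≠ (s : ℂ) ^ 4 →
      p.eval ((z : ℂ) + (z : ℂ)⁻¹) = 0 ∧ q.eval ((z : ℂ) + (z : ℂ)⁻¹) = 0 := by
    intro hne
    have hz : (z : ℂ) ≠ 0 := z.ne_zero
    have H (x y : Bool) : p.eval ((z : ℂ) + (z : ℂ)⁻¹) * cupWeight s x y +
        q.eval ((z : ℂ) + (z : ℂ)⁻¹) * (twist z x * cupWeight s y x) = 0 := by
      have := congrArg (fun f => spin s z f (fun _ => 1) [x, y]) h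
      simpa only [map_add, LinearMap.add_apply, spin_poly_smul, Pi.add_apply, Pi.smul_apply,
        spin_cPlus, spin_cMinus, smul_eq_mul, map_zero, LinearMap.zero_apply, Pi.zero_apply]
        using this
    have h₁ := H true false
    have h₂ := H false true
    simp only [cupWeight, twist] at h₁ h₂
    generalize p.eval ((z : ℂ) + (z : ℂ)⁻¹) = P at *
    generalize q.eval ((z : ℂ) + (z : ℂ)⁻¹) = Q at *
    field_simp at h₁ h₂
    have hd := sub_ne_zero.2 hne
    constructor
    -- Cramer's rule; the coefficients below are cofactors of the cleared system.
    · refine (mul_eq_zero.1 (?_ : ((z : ℂ) ^ 2 - (s : ℂ) ^ 4) * P = 0)).resolve_left hd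
      linear_combination (-(s : ℂ) ^ 2) * h₁ - z * h₂
    · refine (mul_eq_zero.1 (?_ : ((z : ℂ) ^ 2 - (s : ℂ) ^ 4) * Q = 0)).resolve_left hd
      linear_combination (-(z : ℂ)) * h₁ - (s : ℂ) ^ 2 * h₂
  have fin (r : Polynomial ℂ) (hr : ∀ z : ℂˣ, (z : ℂ) ^ 2 ≠ (s : ℂ) ^ 4 →
      r.eval ((z : ℂ) + (z : ℂ)⁻¹) = 0) : r = 0 := by
    -- If `z² = s⁴` then `z = ±s²`, so `z + z⁻¹ = ±(s² + s⁻²)`. This nonzero polynomial vanishes at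
    -- both values, and its product with `r` vanishes everywhere.
    have hd : (Polynomial.X ^ 2 - Polynomial.C (((s : ℂ) ^ 2 + ((s : ℂ) ^ 2)⁻¹) ^ 2) :
        Polynomial ℂ) ≠ 0 := Polynomial.X_pow_sub_C_ne_zero two_pos _
    refine (mul_eq_zero.1 (Polynomial.funext fun u => ?_ : _ * r = 0)).resolve_left hd
    obtain ⟨z, rfl⟩ := exists_units_add_inv u
    have hz : (z : ℂ) ≠ 0 := z.ne_zero
    rw [Polynomial.eval_mul, Polynomial.eval_zero]
    by_cases hz2 : (z : ℂ) ^ 2 = (s : ℂ) ^ 4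
    · refine mul_eq_zero_of_left ?_ _
      simp only [Polynomial.eval_sub, Polynomial.eval_pow, Polynomial.eval_X, Polynomial.eval_C]
      rcases sq_eq_sq_iff_eq_or_eq_neg.1 (hz2.trans (by ring : _ = ((s : ℂ) ^ 2) ^ 2)) with h | h
      · rw [h, sub_self]
      · rw [h, inv_neg]; ring
    · exact mul_eq_zero_of_right _ (hr z hz2)
  exact ⟨fin p fun z hz => (key z hz).1, fin q fun z hz => (key z hz).2⟩

/-- `Hom(0, 2)` is free over `ℂ[X]` with basis `c₊`, `c₋`. -/
def polyEquiv (s : ℂˣ) : (Polynomial ℂ × Polynomial ℂ) ≃ₗ[Polynomial ℂ] (obj s 0 ⟶ obj s 2) :=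
  LinearEquiv.ofBijective ((LinearMap.toSpanSingleton (Polynomial ℂ) _ (cPlus s)).coprod
    (LinearMap.toSpanSingleton (Polynomial ℂ) _ (cMinus s))) <| by
    constructor
    · rw [← LinearMap.ker_eq_bot, LinearMap.ker_eq_bot']
      rintro ⟨p, q⟩ h
      obtain ⟨rfl, rfl⟩ := poly_eq_zero_of_smul_cPlus_add (by simpa using h)
      rfl
    · intro f
      obtain ⟨p, q, rfl⟩ := exists_poly_smul_cPlus_add f
      exact ⟨(p, q), by simp⟩

theorem polyEquiv_symm_cPlus : (polyEquiv s).symm (cPlus s) = (1, 0) := by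
  rw [LinearEquiv.symm_apply_eq]
  exact (show cPlus s = (1 : Polynomial ℂ) • cPlus s + (0 : Polynomial ℂ) • cMinus s by simp)

theorem polyEquiv_symm_cMinus : (polyEquiv s).symm (cMinus s) = (0, 1) := by
  rw [LinearEquiv.symm_apply_eq]
  exact (show cMinus s = (0 : Polynomial ℂ) • cPlus s + (1 : Polynomial ℂ) • cMinus s by simp)

/-- The spin representation itself fails to separate `c₊` from `c₋` at the exceptional values of
`u`. Freeness over `ℂ[X]` does not: the coordinate maps followed by evaluation at `u` give the dual
functionals for every `u`. -/
theorem eq_zero_of_smul_mk_cPlus_add {u a b : ℂ}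
    (h : a • VEven.mk s u (cPlus s) + b • VEven.mk s u (cMinus s) = 0) : a = 0 ∧ b = 0 := by
  let ev : Polynomial ℂ →ₗ[Polynomial ℂ] C₀ u :=
    LinearMap.toSpanSingleton (Polynomial ℂ) (C₀ u) (show C₀ u from (1 : ℂ))
  have h1 : (show ℂ from ev 1) = 1 := by
    change Polynomial.eval u 1 * (1 : ℂ) = 1
    simp
  have h0 : (show ℂ from ev 0) = 0 := map_zero ev
  constructor
  · have H := congrArg (VEven.functional
      (ev ∘ₗ LinearMap.fst _ _ _ ∘ₗ (polyEquiv s).symm.toLinearMap)) h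
    rw [map_add, map_smul, map_smul, map_zero, VEven.functional_mk, VEven.functional_mk] at H
    simpa [polyEquiv_symm_cPlus, polyEquiv_symm_cMinus, h0, h1] using H
  · have H := congrArg (VEven.functional
      (ev ∘ₗ LinearMap.snd _ _ _ ∘ₗ (polyEquiv s).symm.toLinearMap)) h
    rw [map_add, map_smul, map_smul, map_zero, VEven.functional_mk, VEven.functional_mk] at H
    simpa [polyEquiv_symm_cPlus, polyEquiv_symm_cMinus, h0, h1] using H

/-- On one strand `ρ` is diagonal, being the passage through the seam; the state `[true]` is its
eigenvector with eigenvalue `z`. -/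
theorem spin_rho_zpow_comp (z : ℂˣ) {n : ℕ} (k : ℤ) (f : obj s 1 ⟶ obj s n) (c : ℂ) :
    spin s z (((rho s ^ k : (TL s 1)ˣ) : TL s 1) ≫ f) (fun w => if w = [true] then c else 0) =
      ((z ^ k : ℂˣ) : ℂ) • spin s z f (fun w => if w = [true] then c else 0) := by
  have h₁ {n : ℕ} (f : obj s 1 ⟶ obj s n) (c : ℂ) : spin s z ((rho s : TL s 1) ≫ f)
      (fun w => if w = [true] then c else 0) =
        (z : ℂ) • spin s z f (fun w => if w = [true] then c else 0) := by
    rw [spin_comp, LinearMap.comp_apply, ← map_smul]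
    refine spin_congr s z f fun w hw => ?_
    obtain ⟨x, rfl⟩ := List.length_eq_one_iff.1 hw
    rw [show ((rho s : TL s 1) : obj s 1 ⟶ obj s 1) = skein s (rot 0) from rfl,
      spin_skein s z (n := 1) _ _ rfl]
    cases x <;> simp [Diagram.act, rotAct_cons, twist]
  induction k using Int.induction_on generalizing f with
  | zero => simp
  | succ k ih =>
    rw [add_comm, zpow_add, zpow_one, Units.val_mul,
      show (rho s : TL s 1) * _ = _ ≫ (rho s : TL s 1) from rfl, Category.assoc, ih, h₁,
      smul_smul, zpow_add, zpow_one, mul_comm, Units.val_mul]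
  | pred k ih =>
    have h := ih ((rho s : TL s 1) ≫ (((rho s)⁻¹ : (TL s 1)ˣ) : TL s 1) ≫ f)
    have hf : (rho s : TL s 1) ≫ (((rho s)⁻¹ : (TL s 1)ˣ) : TL s 1) ≫ f = f := by
      rw [← Category.assoc]
      exact (congrArg (· ≫ f) (rho s).inv_mul).trans (Category.id_comp f)
    have h₂ := h₁ ((((rho s)⁻¹ : (TL s 1)ˣ) : TL s 1) ≫ f) c
    rw [hf] at h₂
    have h₃ := ih ((((rho s)⁻¹ : (TL s 1)ˣ) : TL s 1) ≫ f)
    rw [sub_eq_neg_add, zpow_add, zpow_neg_one, Units.val_mul,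
      show (((rho s)⁻¹ : (TL s 1)ˣ) : TL s 1) * _ = _ ≫ (((rho s)⁻¹ : (TL s 1)ˣ) : TL s 1) from rfl,
      Category.assoc, h₃, h₂, smul_smul, zpow_add, zpow_neg_one, mul_comm z⁻¹, Units.val_mul,
      mul_assoc, Units.inv_mul, mul_one]

/-- With the twist `z = v`, the diagonal entry at `[true]` is linear over `ℂ[ρ^{±1}]` with values in
`ℂ_v`, and it equals `1` on the identity. -/
theorem exists_functional_VOdd_one (s v : ℂˣ) :
    ∃ L : VOdd s 1 v →ₗ[ℂ] ℂ, L (VOdd.mk s v (𝟙 (obj s 1))) = 1 := by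
  refine ⟨VOdd.functional
    { toFun := fun f => (show C₁ v from spin s v f (fun w => if w = [true] then 1 else 0) [true])
      map_add' := fun f g => by rw [map_add]; rfl
      map_smul' := fun p f => ?_ }, ?_⟩
  · rw [RingHom.id_apply, C₁_smul_def]
    induction p using LaurentPolynomial.induction_on' with
    | add p q hp hq =>
      rw [add_smul, map_add, map_add]
      exact (congrArg₂ (fun a b : ℂ => a + b) hp hq).trans (add_mul _ _ _).symm
    | C_mul_T k a =>
      rw [laurent_C_mul_T_smul, map_smul, LinearMap.smul_apply, spin_rho_zpow_comp,
        LaurentPolynomial.eval₂_C_mul_T, smul_smul]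
      rfl
  · rw [VOdd.functional_mk]
    change spin s v (𝟙 (obj s 1)) (fun w => if w = [true] then 1 else 0) [true] = 1
    rw [← skein_idn, spin_skein s v (n := 1) _ _ rfl]
    simp [Diagram.act]

/-! ## Arc insertion on generators -/

theorem insertionHom_skein (n : ℕ) (D : Diagram n n) :
    insertionHom s n (skein s D) = skein s D.ins := SkeinHom.ins_skein D

/-- The loop meets the inserted arc in one crossing. Smoothing it merges the loop with the arc,
which then winds once around the annulus, counterclockwise for the coefficient `s` and clockwise for
`s⁻¹`. -/
theorem insertionHom_ncLoop : insertionHom s 0 (ncLoop s) =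
    (s : ℂ) • (rho s : TL s 1) + (s : ℂ)⁻¹ • (((rho s)⁻¹ : (TL s 1)ˣ) : TL s 1) := by
  have hcap : skein s (cup 0 1 : Diagram 1 3) ≫ skein s (cap 1 0 : Diagram 3 1) = 𝟙 (obj s 1) :=
    skein_zigzag 0 0 _ _ _ _
  have h₁ : skein s (cup 0 1 : Diagram 1 3) ≫ turn s 3 ≫ skein s (cap 0 1 : Diagram 3 1) =
      turn s 1 := by
    rw [← Category.assoc, piece_turn .cup 0 0 (m := 1) (n := 3) rfl rfl rfl rfl, Category.assoc,
      show skein s (piece .cup (0 + 1) 0 rfl rfl : Diagram 1 3) ≫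
        skein s (cap 0 1 : Diagram 3 1) = 𝟙 (obj s 1) from skein_zagzig 0 0 _ _ _ _]
    exact Category.comp_id _
  -- One forward step moves the cup only halfway through the seam; `cup_rot_rot` rewrites this as a
  -- cup on the other side followed by one backward step, and the backward step passes through the
  -- cap.
  have h₂ : skein s (cup 1 0 : Diagram 1 3) ≫ turn s 3 ≫ skein s (cap 0 1 : Diagram 3 1) =
      turnInv s 1 := by
    have h := skein_sound (s := s) (PlanarIsotopy.cup_rot_rot 1)
    rw [skein_comp, skein_comp] at h
    have h₃ : skein s (cup 1 0 : Diagram 1 3) ≫ turn s 3 =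
        skein s (cup 0 1 : Diagram 1 3) ≫ turnInv s 3 := by
      rw [← h]
      simp only [Category.assoc]
      exact (congrArg (skein s (cup 1 0 : Diagram 1 3) ≫ ·) ((congrArg (turn s 3 ≫ ·)
        (turn_turnInv 3)).trans (Category.comp_id _))).symm
    have h₄ : turnInv s 3 ≫ skein s (cap 0 1 : Diagram 3 1) =
        skein s (cap 1 0 : Diagram 3 1) ≫ turnInv s 1 := by
      have h₅ := piece_turn (s := s) .cap 0 0 (m := 3) (n := 1) rfl rfl rfl rfl
      rw [← Category.comp_id (skein s (cap 0 1)), ← turn_turnInv, ← Category.assoc (skein s _)]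
      erw [h₅]
      rw [Category.assoc, ← Category.assoc, turnInv_turn, Category.id_comp]
    rw [← Category.assoc, h₃, Category.assoc, h₄, ← Category.assoc, hcap]
    exact Category.id_comp _
  have h : insertionHom s 0 (ncLoop s) = skein s (cup 0 1 : Diagram 1 3) ≫
      (skein s (pos 1 0 : Diagram 3 3) ≫ turn s 3) ≫ skein s (cap 0 1 : Diagram 3 1) := by
    refine (insertionHom_skein 0 _).trans ?_
    simp only [Diagram.ins, skein_comp, Category.assoc]
    rfl
  rw [h, skein_pos 1 0 (k := 3) (l := 1), Preadditive.add_comp, Preadditive.add_comp,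
    Preadditive.comp_add]
  simp only [Linear.smul_comp, Linear.comp_smul, Category.id_comp, Category.assoc]
  rw [h₁, h₂, ← Category.assoc (skein s (cup 0 1)), hcap, Category.id_comp,
    Units.val_inv_eq_inv_val]
  rfl

theorem insertionHom_rho :
    insertionHom s 1 (rho s) = skein s (pos 0 0 : Diagram 2 2) ≫ skein s (rot 1) :=
  (insertionHom_skein 1 _).trans (skein_comp _ _)

/-- The crossing on top of the cup is a curl, with the framing factor `s - s⁻¹ (s² + s⁻²) = -s⁻³`.
-/
theorem cPlus_comp_insertionHom_rho : cPlus s ≫ insertionHom s 1 (rho s) =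
    (-((s : ℂ) ^ 3)⁻¹) • cMinus s := by
  have hs : (s : ℂ) ≠ 0 := s.ne_zero
  rw [insertionHom_rho, skein_pos 0 0 (k := 2) (l := 0)]
  simp only [Preadditive.add_comp, Preadditive.comp_add, Linear.smul_comp, Linear.comp_smul,
    Category.id_comp, Category.assoc]
  rw [cPlus_comp_rot, cPlus, ← Category.assoc, skein_loop 0 0 (k := 2) (l := 0), Linear.smul_comp,
    Category.id_comp, ← cPlus, cPlus_comp_rot, smul_smul, ← add_smul, Units.val_inv_eq_inv_val]
  congr 1
  field_simp
  ring

/-- Here the cap closes the arc through the lower half into a noncontractible loop; this is how `u`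
enters the action on `V_2(u)`. -/
theorem cMinus_comp_insertionHom_rho : cMinus s ≫ insertionHom s 1 (rho s) =
    (s : ℂ) • cPlus s + (s : ℂ)⁻¹ • (ncLoop s ≫ cMinus s) := by
  have h : cMinus s ≫ skein s (cap 0 0 : Diagram 2 0) = ncLoop s := (skein_comp _ _).symm
  rw [insertionHom_rho, skein_pos 0 0 (k := 2) (l := 0)]
  simp only [Preadditive.add_comp, Preadditive.comp_add, Linear.smul_comp, Linear.comp_smul,
    Category.id_comp, Category.assoc]
  rw [cMinus_comp_rot, ← Category.assoc (cMinus s), h, Units.val_inv_eq_inv_val]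
  congr 3
  exact cPlus_comp_rot

theorem insertionHom_rho_smul_mk (u a b : ℂ) :
    insertionHom s 1 (rho s) • (a • VEven.mk s u (cPlus s) + b • VEven.mk s u (cMinus s)) =
      (s * b) • VEven.mk s u (cPlus s) +
        (-((s : ℂ) ^ 3)⁻¹ * a + (s : ℂ)⁻¹ * u * b) • VEven.mk s u (cMinus s) := by
  rw [← VEven.mk_smul, ← VEven.mk_smul, ← VEven.mk_add, VEven.smul_mk, Preadditive.add_comp,
    Linear.smul_comp, Linear.smul_comp, cPlus_comp_insertionHom_rho, cMinus_comp_insertionHom_rho,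
    ← poly_X_smul]
  simp only [VEven.mk_add, VEven.mk_smul, VEven.mk_poly_smul, Polynomial.eval_X]
  module

/-! ## One-dimensional modules and intertwiners -/

theorem VEven.zero_eq_smul {u : ℂ} (x : VEven s 0 u) :
    ∃ c : ℂ, x = c • VEven.mk s u (𝟙 (obj s 0)) := by
  obtain ⟨f, rfl⟩ := VEven.mk_surjective x
  obtain ⟨p, rfl⟩ := exists_poly_smul f
  exact ⟨_, VEven.mk_poly_smul p _⟩

theorem VOdd.one_eq_smul {v : ℂˣ} (x : VOdd s 1 v) :
    ∃ c : ℂ, x = c • VOdd.mk s v (𝟙 (obj s 1)) := by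
  obtain ⟨f, rfl⟩ := VOdd.mk_surjective x
  obtain ⟨p, rfl⟩ := exists_laurent_smul f
  exact ⟨_, VOdd.mk_laurent_smul p _⟩

theorem VEven.two_eq {u : ℂ} (x : VEven s 2 u) :
    ∃ a b : ℂ, x = a • VEven.mk s u (cPlus s) + b • VEven.mk s u (cMinus s) := by
  obtain ⟨f, rfl⟩ := VEven.mk_surjective x
  obtain ⟨p, q, rfl⟩ := exists_poly_smul_cPlus_add f
  exact ⟨_, _, by rw [VEven.mk_add, VEven.mk_poly_smul, VEven.mk_poly_smul]⟩

theorem VEven.smul_assoc {n : ℕ} {u : ℂ} (c : ℂ) (a : TL s n) (x : VEven s n u) :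
    (c • a) • x = c • (a • x) := by
  obtain ⟨f, rfl⟩ := VEven.mk_surjective x
  rw [VEven.smul_mk, VEven.smul_mk, ← VEven.mk_smul, Linear.comp_smul]

theorem VOdd.smul_assoc {n : ℕ} {v : ℂˣ} (c : ℂ) (a : TL s n) (x : VOdd s n v) :
    (c • a) • x = c • (a • x) := by
  obtain ⟨f, rfl⟩ := VOdd.mk_surjective x
  rw [VOdd.smul_mk, VOdd.smul_mk, ← VOdd.mk_smul, Linear.comp_smul]

theorem ncLoop_smul_mk (u : ℂ) :
    ncLoop s • VEven.mk s u (𝟙 (obj s 0)) = u • VEven.mk s u (𝟙 (obj s 0)) := by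
  rw [VEven.smul_mk, Category.id_comp, ← Category.comp_id (ncLoop s), ← poly_X_smul,
    VEven.mk_poly_smul, Polynomial.eval_X]

theorem rho_zpow_smul_mk (v : ℂˣ) (k : ℤ) :
    ((rho s ^ k : (TL s 1)ˣ) : TL s 1) • VOdd.mk s v (𝟙 (obj s 1)) =
      ((v ^ k : ℂˣ) : ℂ) • VOdd.mk s v (𝟙 (obj s 1)) := by
  rw [VOdd.smul_mk, Category.id_comp, ← Category.comp_id ((rho s ^ k : (TL s 1)ˣ) : TL s 1),
    ← laurent_T_smul, VOdd.mk_laurent_smul, LaurentPolynomial.eval₂_T]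

theorem rho_smul_mk (v : ℂˣ) :
    (rho s : TL s 1) • VOdd.mk s v (𝟙 (obj s 1)) = (v : ℂ) • VOdd.mk s v (𝟙 (obj s 1)) := by
  simpa using rho_zpow_smul_mk (s := s) v 1

theorem rho_inv_smul_mk (v : ℂˣ) :
    (((rho s)⁻¹ : (TL s 1)ˣ) : TL s 1) • VOdd.mk s v (𝟙 (obj s 1)) =
      (v : ℂ)⁻¹ • VOdd.mk s v (𝟙 (obj s 1)) := by
  have := rho_zpow_smul_mk (s := s) v (-1)
  rwa [zpow_neg_one, zpow_neg_one, Units.val_inv_eq_inv_val] at this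

theorem insertionHom_ncLoop_smul_mk (v : ℂˣ) :
    insertionHom s 0 (ncLoop s) • VOdd.mk s v (𝟙 (obj s 1)) =
      (s * v + (s : ℂ)⁻¹ * (v : ℂ)⁻¹) • VOdd.mk s v (𝟙 (obj s 1)) := by
  rw [insertionHom_ncLoop, add_smul, VOdd.smul_assoc, VOdd.smul_assoc]
  rw [rho_smul_mk, rho_inv_smul_mk, smul_smul, smul_smul, add_smul]

/-- An eigenvector of a unit with eigenvalue `v` is an eigenvector of its inverse with eigenvalue
`v⁻¹`, so the equation for `ρ` alone controls all of `TL_1`. -/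
theorem units_zpow_smul_eq {B M : Type} [Ring B] [AddCommGroup M] [Module ℂ M] [Module B M]
    [SMulCommClass B ℂ M] {g : Bˣ} {v : ℂˣ} {w : M} (h : (g : B) • w = (v : ℂ) • w) (k : ℤ) :
    ((g ^ k : Bˣ) : B) • w = ((v ^ k : ℂˣ) : ℂ) • w := by
  have hinv : ((g⁻¹ : Bˣ) : B) • w = ((v⁻¹ : ℂˣ) : ℂ) • w := by
    have h₂ : ((g⁻¹ : Bˣ) : B) • (v : ℂ) • w = w := by
      rw [← h, smul_smul, Units.inv_mul, one_smul]
    rw [smul_comm] at h₂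
    rw [← Units.smul_def v⁻¹, eq_inv_smul_iff]
    exact h₂
  induction k using Int.induction_on with
  | zero => simp
  | succ k ih =>
    rw [zpow_add, zpow_add, zpow_one, zpow_one, Units.val_mul, Units.val_mul, mul_smul, h,
      smul_comm, ih, smul_smul, mul_comm]
  | pred k ih =>
    rw [sub_eq_add_neg, zpow_add, zpow_add, zpow_neg_one, zpow_neg_one, Units.val_mul,
      Units.val_mul, mul_smul, hinv, smul_comm, ih, smul_smul, mul_comm]

/-- `V_0(u)` is spanned by the vacuum and `TL_0` by powers of the loop, so compatibility with the
single generator on the single vector suffices. -/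
theorem mem_intertwiners_zero {u : ℂ} {v : ℂˣ} (f : VEven s 0 u →ₗ[ℂ] VOdd s 1 v)
    (h : insertionHom s 0 (ncLoop s) • f (VEven.mk s u (𝟙 (obj s 0))) =
      u • f (VEven.mk s u (𝟙 (obj s 0)))) :
    f ∈ intertwiners (insertionHom s 0) (VEven s 0 u) (VOdd s 1 v) := by
  have key (a : TL s 0) : f (a • VEven.mk s u (𝟙 (obj s 0))) =
      insertionHom s 0 a • f (VEven.mk s u (𝟙 (obj s 0))) := by
    have ha : a ∈ Submodule.span ℂ (Set.range fun k : ℕ => (ncLoop s ^ k : TL s 0)) := by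
      rw [span_ncLoop_pow]; trivial
    induction ha using Submodule.span_induction with
    | mem x hx =>
      obtain ⟨k, rfl⟩ := hx
      have h₁ : ncLoop s ^ k • VEven.mk s u (𝟙 (obj s 0)) =
          u ^ k • VEven.mk s u (𝟙 (obj s 0)) := by
        induction k with
        | zero => rw [pow_zero, pow_zero, one_smul, one_smul]
        | succ k ih => rw [pow_succ, mul_smul, ncLoop_smul_mk, smul_comm, ih, smul_smul, pow_succ']
      have h₂ : insertionHom s 0 (ncLoop s) ^ k • f (VEven.mk s u (𝟙 (obj s 0))) =
          u ^ k • f (VEven.mk s u (𝟙 (obj s 0))) := by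
        clear h₁
        induction k with
        | zero => rw [pow_zero, pow_zero, one_smul, one_smul]
        | succ k ih => rw [pow_succ, mul_smul, h, smul_comm, ih, smul_smul, pow_succ']
      change f (ncLoop s ^ k • _) = insertionHom s 0 (ncLoop s ^ k) • _
      rw [h₁, map_smul, map_pow, h₂]
    | zero => rw [zero_smul, map_zero, map_zero, zero_smul]
    | add x y _ _ hx hy => rw [add_smul, map_add, map_add, add_smul, hx, hy]
    | smul c x _ hx =>
      rw [VEven.smul_assoc, f.map_smul, map_smul (insertionHom s 0), hx]
      exact (VOdd.smul_assoc (n := 1) c _ _).symm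
  intro a x
  obtain ⟨c, rfl⟩ := VEven.zero_eq_smul x
  rw [smul_comm, f.map_smul, f.map_smul, key]
  exact (smul_comm (insertionHom s 0 a : TL s 1) c _).symm

theorem mem_intertwiners_one {u : ℂ} {v : ℂˣ} (f : VOdd s 1 v →ₗ[ℂ] VEven s 2 u)
    (h : insertionHom s 1 (rho s) • f (VOdd.mk s v (𝟙 (obj s 1))) =
      (v : ℂ) • f (VOdd.mk s v (𝟙 (obj s 1)))) :
    f ∈ intertwiners (insertionHom s 1) (VOdd s 1 v) (VEven s 2 u) := by
  have key (a : TL s 1) : f (a • VOdd.mk s v (𝟙 (obj s 1))) =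
      insertionHom s 1 a • f (VOdd.mk s v (𝟙 (obj s 1))) := by
    have ha : a ∈ Submodule.span ℂ
        (Set.range fun k : ℤ => ((rho s ^ k : (TL s 1)ˣ) : TL s 1)) := by
      rw [span_rho_zpow]; trivial
    induction ha using Submodule.span_induction with
    | mem x hx =>
      obtain ⟨k, rfl⟩ := hx
      -- The image of `ρ` under arc insertion is again a unit, so negative powers are covered as
      -- well.
      have h₂ := units_zpow_smul_eq
        (g := Units.map (insertionHom s 1 : TL s 1 →* TL s 2) (rho s)) h k
      rw [← map_zpow] at h₂
      change f (((rho s ^ k : (TL s 1)ˣ) : TL s 1) • _) = _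
      rw [rho_zpow_smul_mk, map_smul, ← h₂]
      rfl
    | zero => rw [zero_smul, map_zero, map_zero, zero_smul]
    | add x y _ _ hx hy => rw [add_smul, map_add, map_add, add_smul, hx, hy]
    | smul c x _ hx =>
      rw [VOdd.smul_assoc, f.map_smul, map_smul (insertionHom s 1), hx]
      exact (VEven.smul_assoc (n := 2) c _ _).symm
  intro a x
  obtain ⟨c, rfl⟩ := VOdd.one_eq_smul x
  rw [smul_comm, f.map_smul, f.map_smul, key]
  exact (smul_comm (insertionHom s 1 a : TL s 2) c _).symm

theorem VEven.hom_ext {u : ℂ} {M : Type} [AddCommGroup M] [Module ℂ M]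
    {f g : VEven s 0 u →ₗ[ℂ] M}
    (h : f (VEven.mk s u (𝟙 (obj s 0))) = g (VEven.mk s u (𝟙 (obj s 0)))) : f = g := by
  ext1 x
  obtain ⟨c, rfl⟩ := VEven.zero_eq_smul x
  rw [map_smul, map_smul, h]

theorem VOdd.hom_ext {v : ℂˣ} {M : Type} [AddCommGroup M] [Module ℂ M]
    {f g : VOdd s 1 v →ₗ[ℂ] M}
    (h : f (VOdd.mk s v (𝟙 (obj s 1))) = g (VOdd.mk s v (𝟙 (obj s 1)))) : f = g := by
  ext1 x
  obtain ⟨c, rfl⟩ := VOdd.one_eq_smul x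
  rw [map_smul, map_smul, h]

theorem VOdd.mk_one_ne_zero (v : ℂˣ) : VOdd.mk s v (𝟙 (obj s 1)) ≠ 0 := by
  obtain ⟨L, hL⟩ := exists_functional_VOdd_one s v
  intro h
  rw [h, map_zero] at hL
  exact zero_ne_one hL

theorem VEven.mk_bigU (u : ℂ) (v : ℂˣ) : VEven.mk s u (bigU s v) =
    (s : ℂ) • VEven.mk s u (cPlus s) + (v : ℂ) • VEven.mk s u (cMinus s) := by
  rw [bigU, VEven.mk_add, VEven.mk_smul, VEven.mk_smul]

theorem VEven.exists_eq_smul {u : ℂ} {v : ℂˣ} {φ₀ : VEven s 0 u →ₗ[ℂ] VOdd s 1 v}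
    (hφ : φ₀ (VEven.mk s u (𝟙 (obj s 0))) = VOdd.mk s v (𝟙 (obj s 1)))
    (f : VEven s 0 u →ₗ[ℂ] VOdd s 1 v) : ∃ c : ℂ, f = c • φ₀ := by
  obtain ⟨c, hc⟩ := VOdd.one_eq_smul (f (VEven.mk s u (𝟙 (obj s 0))))
  exact ⟨c, VEven.hom_ext (by rw [hc, LinearMap.smul_apply, hφ])⟩

theorem insertionHom_rho_smul_bigU {u : ℂ} {v : ℂˣ}
    (hu : u = s * v + (s : ℂ)⁻¹ * (v : ℂ)⁻¹) :
    insertionHom s 1 (rho s) • VEven.mk s u (bigU s v) = (v : ℂ) • VEven.mk s u (bigU s v) := by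
  have hs : (s : ℂ) ≠ 0 := s.ne_zero
  have hv : (v : ℂ) ≠ 0 := v.ne_zero
  rw [VEven.mk_bigU, insertionHom_rho_smul_mk, smul_add, smul_smul, smul_smul, mul_comm (v : ℂ) s]
  congr 2
  rw [hu]
  field_simp
  ring

/-- Independence of `c₊`, `c₋` permits comparing coordinates. The `c₊`-coordinate alone gives `s b =
v a`, that is, proportionality to `(s, v)`; the relation between `u` and `v` plays no part in this
direction. -/
theorem eq_smul_bigU_of_eigenvector {u : ℂ} {v : ℂˣ} {w : VEven s 2 u}
    (h : insertionHom s 1 (rho s) • w = (v : ℂ) • w) :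
    ∃ c : ℂ, w = c • VEven.mk s u (bigU s v) := by
  have hs : (s : ℂ) ≠ 0 := s.ne_zero
  obtain ⟨a, b, rfl⟩ := VEven.two_eq w
  rw [insertionHom_rho_smul_mk, ← sub_eq_zero] at h
  obtain ⟨h₁, -⟩ := eq_zero_of_smul_mk_cPlus_add (s := s) (u := u) (a := s * b - v * a)
    (b := -((s : ℂ) ^ 3)⁻¹ * a + (s : ℂ)⁻¹ * u * b - v * b) (by rw [← h]; module)
  -- The `c₊`-coefficient of `U` is `s`, which determines the factor.
  refine ⟨a / s, ?_⟩
  rw [VEven.mk_bigU, smul_add, smul_smul, smul_smul, div_mul_cancel₀ a hs]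
  congr 2
  field_simp
  linear_combination h₁

end AnnularSkein

/-! ### The two spaces of intertwiners -/

open AnnularSkein in
theorem mainTheorem12 (s v : ℂˣ) (u : ℂ) :
    (∃ φ₀ : VEven s 0 u →ₗ[ℂ] VOdd s 1 v,
      φ₀ (VEven.mk s u (𝟙 (obj s 0))) = VOdd.mk s v (𝟙 (obj s 1)) ∧
      (∀ ψ : VEven s 0 u →ₗ[ℂ] VOdd s 1 v,
        ψ (VEven.mk s u (𝟙 (obj s 0))) = VOdd.mk s v (𝟙 (obj s 1)) → ψ = φ₀) ∧
      φ₀ ≠ 0 ∧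
      (u = s * v + (s : ℂ)⁻¹ * (v : ℂ)⁻¹ →
        intertwiners (insertionHom s 0) (VEven s 0 u) (VOdd s 1 v) = Submodule.span ℂ {φ₀}) ∧
      (u ≠ s * v + (s : ℂ)⁻¹ * (v : ℂ)⁻¹ →
        intertwiners (insertionHom s 0) (VEven s 0 u) (VOdd s 1 v) = ⊥)) ∧
    (u = s * v + (s : ℂ)⁻¹ * (v : ℂ)⁻¹ →
      ∃ φ₁ : VOdd s 1 v →ₗ[ℂ] VEven s 2 u,
        φ₁ (VOdd.mk s v (𝟙 (obj s 1))) = VEven.mk s u (bigU s v) ∧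
        (∀ ψ : VOdd s 1 v →ₗ[ℂ] VEven s 2 u,
          ψ (VOdd.mk s v (𝟙 (obj s 1))) = VEven.mk s u (bigU s v) → ψ = φ₁) ∧
        intertwiners (insertionHom s 1) (VOdd s 1 v) (VEven s 2 u) = Submodule.span ℂ {φ₁} ∧
        Module.finrank ℂ (intertwiners (insertionHom s 1) (VOdd s 1 v) (VEven s 2 u)) = 1) := by
  constructor
  · obtain ⟨L, hL⟩ := exists_functional_VEven_zero s u
    -- A functional normalized on the generator of `V_0(u)` allows that generator to be sent to any
    -- prescribed vector. Only this value is retained afterwards, since it determines the map.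
    have hφ : L.smulRight (VOdd.mk s v (𝟙 (obj s 1))) (VEven.mk s u (𝟙 (obj s 0))) =
        VOdd.mk s v (𝟙 (obj s 1)) := by
      rw [LinearMap.smulRight_apply, hL, one_smul]
    generalize L.smulRight (VOdd.mk s v (𝟙 (obj s 1))) = φ₀ at hφ
    refine ⟨φ₀, hφ, fun ψ hψ => VEven.hom_ext (hψ.trans hφ.symm), ?_, fun hu => ?_, fun hu => ?_⟩
    · rintro rfl
      exact VOdd.mk_one_ne_zero v hφ.symm
    · refine le_antisymm (fun f _ => ?_) ((Submodule.span_singleton_le_iff_mem _ _).2 ?_)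
      · obtain ⟨c, rfl⟩ := VEven.exists_eq_smul hφ f
        exact Submodule.smul_mem _ _ (Submodule.mem_span_singleton_self _)
      · refine mem_intertwiners_zero φ₀ ?_
        rw [hφ, insertionHom_ncLoop_smul_mk, ← hu]
    · refine (Submodule.eq_bot_iff _).2 fun f hf => ?_
      obtain ⟨c, rfl⟩ := VEven.exists_eq_smul hφ f
      have h := hf (ncLoop s) (VEven.mk s u (𝟙 (obj s 0)))
      -- Testing the intertwiner `c φ₀` on the loop compares the eigenvalue `u` with `s v + s⁻¹
      -- v⁻¹`; if they differ, `c` must vanish.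
      rw [ncLoop_smul_mk, map_smul, LinearMap.smul_apply, hφ, smul_comm (insertionHom s 0 _) c,
        insertionHom_ncLoop_smul_mk, smul_smul, smul_smul, ← sub_eq_zero, ← sub_smul] at h
      have h₂ := (smul_eq_zero.1 h).resolve_right (VOdd.mk_one_ne_zero v)
      have h₃ : c * (u - (s * v + (s : ℂ)⁻¹ * (v : ℂ)⁻¹)) = 0 := by linear_combination h₂
      rw [(mul_eq_zero.1 h₃).resolve_right (sub_ne_zero.2 hu), zero_smul]
  · intro hu
    obtain ⟨L, hL⟩ := exists_functional_VOdd_one s v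
    have hφ : L.smulRight (VEven.mk s u (bigU s v)) (VOdd.mk s v (𝟙 (obj s 1))) =
        VEven.mk s u (bigU s v) := by
      rw [LinearMap.smulRight_apply, hL, one_smul]
    generalize L.smulRight (VEven.mk s u (bigU s v)) = φ₁ at hφ
    have hspan : intertwiners (insertionHom s 1) (VOdd s 1 v) (VEven s 2 u) =
        Submodule.span ℂ {φ₁} := by
      refine le_antisymm (fun f hf => ?_) ((Submodule.span_singleton_le_iff_mem _ _).2 ?_)
      · have h := hf (rho s) (VOdd.mk s v (𝟙 (obj s 1)))
        rw [rho_smul_mk, map_smul] at h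
        obtain ⟨c, hc⟩ := eq_smul_bigU_of_eigenvector h.symm
        rw [VOdd.hom_ext (f := f) (g := c • φ₁) (by rw [hc, LinearMap.smul_apply, hφ])]
        exact Submodule.smul_mem _ _ (Submodule.mem_span_singleton_self _)
      · refine mem_intertwiners_one φ₁ ?_
        rw [hφ, insertionHom_rho_smul_bigU hu]
    refine ⟨φ₁, hφ, fun ψ hψ => VOdd.hom_ext (hψ.trans hφ.symm), hspan, ?_⟩
    rw [hspan]
    refine finrank_span_singleton ?_
    -- If `φ₁` were zero, `U` would vanish in `V_2(u)`, contradicting independence because its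
    -- `c₊`-coefficient is the unit `s`.
    rintro rfl
    rw [LinearMap.zero_apply, VEven.mk_bigU] at hφ
    exact s.ne_zero (eq_zero_of_smul_mk_cPlus_add hφ.symm).1

end
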